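/- **Theorem (informative sparsity pattern).** *Model.* For $n\ge 1$ let $Y=AHX+W\in\mathbb R^n$, $X_i=S_iU_i$, where $A,H,S,U,W$ are independent; $U_1,\dots,U_n$ are i.i.d. $\mathcal N(0,\sigma^2)$; $W_1,\dots,W_n$ are i.i.d. $\mathcal N(0,1)$; $H$ is an $n\times n$ matrix with i.i.d. entries of mean $0$ and variance $1/n$; $A$ is diagonal with entries in $\{0,1\}$, which are either i.i.d. Bernoulli($q$) or a fixed realization for each $n$; and $S\in\{0,1\}^n$ has law $P(S=s)=C_n\exp\{nf(m_s)\}$ with $m_s=\frac1n\sum_i s_i$, $f$ a real function not depending on $n$, and $C_n$ the normalizing constant. Information is measured in bits. Put $$\mathcal I_1=\limsup_{n\to\infty}\frac{I(Y;X\mid A,H)}{n},\qquad \mathcal I_2=\limsup_{n\to\infty}\frac{I(Y;U\mid A,H,S)}{n}.$$ *Coding.* Information is conveyed only through the patterns $S$, and $U$ is fading unknown to the transmitter and the receiver: one use of the channel takes a pattern $s\in\{0,1\}^n$ chosen by the transmitter and delivers $(A,H,Y)$ to the receiver, where $Y=AHX+W$ with $X_i=s_iU_i$; different uses are independent. The transmitter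 does not know $A,H$. Say that communication in dimension $n$ at rate $r$ (bits per scalar component) is reliable if for every $\varepsilon>0$ and all sufficiently large $N$ there are at least $2^{nNr}$ codewords, each a sequence of $N$ patterns, and a measurable decoder acting on the $N$ received triples, such that every message has error probability at most $\varepsilon$ and the fraction of ones in every codeword differs from $\mathbb E[m_S]$ by at most $\varepsilon$. A rate $R$ is achievable if for every $r<R$ communication at rate $r$ is reliable in infinitely many dimensions $n$. *Claim.* For every $n$ the mutual informations below are finite and $$I(S;Y\mid A,H)=I(X;Y\mid A,H)-I(U;Y\mid A,H,S).$$ Moreover $\mathcal I_1,\mathcal I_2<\infty$, and the rate $R=\mathcal I_1-\mathcal I_2$ is achievable. If the upper limits that define $\mathcal I_1$ and $\mathcal I_2$ are limits, then for every $r<\mathcal I_1-\mathcal I_2$ communication at rate $r$ is reliable in all sufficiently large dimensions $n$. -/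

import Mathlib

open MeasureTheory ProbabilityTheory Filter Topology
open scoped ENNReal NNReal

namespace SparseChannel

noncomputable section

/-- The conditional mutual information `I(X; Y | Z)`, in bits: the Kullback-Leibler divergence of
the joint law of `(Z, X, Y)` from the law under which `X` and `Y` are conditionally independent
given `Z` with the same conditional laws, divided by `ln 2`. -/
def condMutualInfo {Ω α β γ : Type*} [MeasurableSpace Ω]
    [MeasurableSpace α] [StandardBorelSpace α] [Nonempty α]
    [MeasurableSpace β] [StandardBorelSpace β] [Nonempty β] [MeasurableSpace γ]
    (μ : Measure Ω) [IsFiniteMeasure μ] (X : Ω → α) (Y : Ω → β) (Z : Ω → γ) : ℝ≥0∞ :=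
  InformationTheory.klDiv (μ.map fun ω => (Z ω, X ω, Y ω))
      ((μ.map Z) ⊗ₘ ((condDistrib X Z μ) ×ₖ (condDistrib Y Z μ)))
    / ENNReal.ofReal (Real.log 2)

/-- The real number `1` or `0` encoded by a Boolean. -/
def bit (b : Bool) : ℝ := if b then 1 else 0

/-- The magnetization `m_s = (1/n) ∑ s_i` of a binary vector. -/
def magnetization {n : ℕ} (s : Fin n → Bool) : ℝ := (∑ i, bit (s i)) / n

/-- The probability `C_n exp (n f(m_s))` of a binary pattern `s` of length `n`. -/
def patternProb (f : ℝ → ℝ) {n : ℕ} (s : Fin n → Bool) : ℝ :=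
  Real.exp (n * f (magnetization s)) / ∑ s' : Fin n → Bool, Real.exp (n * f (magnetization s'))

/-- The law on binary patterns of length `n` with weights `C_n exp (n f(m_s))`. -/
def patternLaw (f : ℝ → ℝ) (n : ℕ) : Measure (Fin n → Bool) :=
  ∑ s : Fin n → Bool, ENNReal.ofReal (patternProb f s) • Measure.dirac s

theorem sum_patternProb (f : ℝ → ℝ) (n : ℕ) :
    ∑ s : Fin n → Bool, patternProb f s = 1 := by
  unfold patternProb
  rw [← Finset.sum_div]
  exact div_self (Finset.sum_pos (fun s _ => Real.exp_pos _) Finset.univ_nonempty).ne'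

instance (f : ℝ → ℝ) (n : ℕ) : IsProbabilityMeasure (patternLaw f n) := by
  constructor
  have h : ∀ s : Fin n → Bool, 0 ≤ patternProb f s := fun s =>
    div_nonneg (Real.exp_pos _).le (Finset.sum_nonneg fun s _ => (Real.exp_pos _).le)
  simp only [patternLaw, Measure.coe_finsetSum, Finset.sum_apply, Measure.smul_apply,
    measure_univ, smul_eq_mul, mul_one]
  rw [← ENNReal.ofReal_sum_of_nonneg fun s _ => h s, sum_patternProb, ENNReal.ofReal_one]

/-- How the diagonal of the sampling matrix `A` is produced in each dimension `n`: by independent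
Bernoulli(`q`) entries, or as a prescribed deterministic realization. -/
inductive Sampling where
  | bernoulli (q : unitInterval)
  | fixed (a : ∀ n : ℕ, Fin n → Bool)

/-- The law of the diagonal of the sampling matrix in dimension `n`. -/
def Sampling.law : Sampling → (n : ℕ) → Measure (Fin n → Bool)
  | .bernoulli q, _ => Measure.pi fun _ => bernoulliMeasure true false q
  | .fixed a, n => Measure.dirac (a n)

instance (A : Sampling) (n : ℕ) : IsProbabilityMeasure (A.law n) := by
  cases A <;> unfold Sampling.law <;> infer_instance

/-- The data of the model: the sampling mechanism, the law of one entry of the `n × n` matrix `H`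
for each `n`, the variance `σ²` of the Gaussian components, and the function `f` that determines
the law of the sparsity pattern. -/
structure Model where
  sampling : Sampling
  entryLaw : ℕ → ProbabilityMeasure ℝ
  variance : ℝ≥0
  f : ℝ → ℝ

/-- What the receiver observes in one use of the channel: the diagonal of `A`, the matrix `H`, and
the vector `Y`. -/
abbrev Output (n : ℕ) : Type :=
  ((Fin n → Bool) × (Fin n → Fin n → ℝ)) × (Fin n → ℝ)

/-- The input `X` of the linear system, `X_i = S_i U_i`. -/
def sparseSignal {n : ℕ} (s : Fin n → Bool) (u : Fin n → ℝ) : Fin n → ℝ :=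
  fun i => bit (s i) * u i

/-- The output `Y = A H X + W`, where `a` is the diagonal of `A`. -/
def received {n : ℕ} (a : Fin n → Bool) (h : Fin n → Fin n → ℝ) (x w : Fin n → ℝ) : Fin n → ℝ :=
  (Matrix.diagonal (fun i => bit (a i)) * Matrix.of h).mulVec x + w

/-- The law of the matrix `H` in dimension `n`: independent entries with law `entryLaw n`. -/
def Model.matrixLaw (M : Model) (n : ℕ) : Measure (Fin n → Fin n → ℝ) :=
  Measure.pi fun _ => Measure.pi fun _ => (M.entryLaw n : Measure ℝ)

/-- The law of `U` in dimension `n`: independent centred Gaussian entries of variance `σ²`. -/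
def Model.gaussianLaw (M : Model) (n : ℕ) : Measure (Fin n → ℝ) :=
  Measure.pi fun _ => gaussianReal 0 M.variance

/-- The law of the noise `W` in dimension `n`: independent standard Gaussian entries. -/
def noiseLaw (n : ℕ) : Measure (Fin n → ℝ) :=
  Measure.pi fun _ => gaussianReal 0 1

instance (M : Model) (n : ℕ) : IsProbabilityMeasure (M.matrixLaw n) := by
  unfold Model.matrixLaw; infer_instance

instance (M : Model) (n : ℕ) : IsProbabilityMeasure (M.gaussianLaw n) := by
  unfold Model.gaussianLaw; infer_instance

instance (n : ℕ) : IsProbabilityMeasure (noiseLaw n) := by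
  unfold noiseLaw; infer_instance

/-- The sample space of the model in dimension `n`: outcomes of `((A, H), S, U, W)`. -/
abbrev Sample (n : ℕ) : Type :=
  ((Fin n → Bool) × (Fin n → Fin n → ℝ)) × (Fin n → Bool) × (Fin n → ℝ) × (Fin n → ℝ)

/-- The joint law of the independent variables `A, H, S, U, W`. -/
def Model.law (M : Model) (n : ℕ) : Measure (Sample n) :=
  ((M.sampling.law n).prod (M.matrixLaw n)).prod
    ((patternLaw M.f n).prod ((M.gaussianLaw n).prod (noiseLaw n)))

instance (M : Model) (n : ℕ) : IsProbabilityMeasure (M.law n) := by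
  unfold Model.law; infer_instance

namespace Sample

variable {n : ℕ}

/-- The pair `(A, H)`. -/
def AH (ω : Sample n) : (Fin n → Bool) × (Fin n → Fin n → ℝ) := ω.1

/-- The sparsity pattern `S`. -/
def S (ω : Sample n) : Fin n → Bool := ω.2.1

/-- The Gaussian vector `U`. -/
def U (ω : Sample n) : Fin n → ℝ := ω.2.2.1

/-- The noise `W`. -/
def W (ω : Sample n) : Fin n → ℝ := ω.2.2.2

/-- The sparse signal `X`. -/
def X (ω : Sample n) : Fin n → ℝ := sparseSignal (S ω) (U ω)

/-- The output `Y = A H X + W`. -/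
def Y (ω : Sample n) : Fin n → ℝ := received (AH ω).1 (AH ω).2 (X ω) (W ω)

end Sample

/-- `I(X; Y | A, H)` in dimension `n`. -/
def Model.infoX (M : Model) (n : ℕ) : ℝ≥0∞ :=
  condMutualInfo (M.law n) Sample.X Sample.Y Sample.AH

/-- `I(U; Y | A, H, S)` in dimension `n`. -/
def Model.infoU (M : Model) (n : ℕ) : ℝ≥0∞ :=
  condMutualInfo (M.law n) Sample.U Sample.Y fun ω => (Sample.AH ω, Sample.S ω)

/-- `I(S; Y | A, H)` in dimension `n`. -/
def Model.infoS (M : Model) (n : ℕ) : ℝ≥0∞ :=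
  condMutualInfo (M.law n) Sample.S Sample.Y Sample.AH

/-- The information rate `ℐ₁ = limsup I(X; Y | A, H) / n`. -/
def Model.rateX (M : Model) : ℝ≥0∞ :=
  limsup (fun n : ℕ => M.infoX n / n) atTop

/-- The information rate `ℐ₂ = limsup I(U; Y | A, H, S) / n`. -/
def Model.rateU (M : Model) : ℝ≥0∞ :=
  limsup (fun n : ℕ => M.infoU n / n) atTop

/-- The law of the receiver's observation `(A, H, Y)` when the pattern `s` is transmitted; the
fading `U`, which nobody knows, is averaged out. -/
def Model.channel (M : Model) {n : ℕ} (s : Fin n → Bool) : Measure (Output n) :=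
  (((M.sampling.law n).prod (M.matrixLaw n)).prod ((M.gaussianLaw n).prod (noiseLaw n))).map
    fun ω => (ω.1, received ω.1.1 ω.1.2 (sparseSignal s ω.2.1) ω.2.2)

/-- The sparsity rate `E[m_S]` in dimension `n`; by symmetry it equals `P(S_i = 1)` for all `i`. -/
def Model.sparsity (M : Model) (n : ℕ) : ℝ :=
  ∫ s, magnetization s ∂(patternLaw M.f n)

/-- A code of block length `N` for the `n`-dimensional channel: `size` codewords, each a sequence of
`N` patterns, and a measurable decoder acting on the `N` observations of the receiver. -/
structure Code (n N : ℕ) where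
  size : ℕ
  encode : Fin size → Fin N → Fin n → Bool
  decode : (Fin N → Output n) → Fin size
  measurable_decode : Measurable decode

/-- The error probability of a message over `N` independent uses of the channel. -/
def Code.errorProb (M : Model) {n N : ℕ} (C : Code n N) (m : Fin C.size) : ℝ≥0∞ :=
  Measure.pi (fun t => M.channel (C.encode m t)) {o | C.decode o ≠ m}

/-- The fraction of ones in the codeword of a message. -/
def Code.fractionOfOnes {n N : ℕ} (C : Code n N) (m : Fin C.size) : ℝ :=
  (∑ t, magnetization (C.encode m t)) / N

/-- Reliable communication in dimension `n` at rate `r` (in bits per scalar component): for every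
`ε > 0` and every large block length `N` there is a code with at least `2 ^ (n N r)` messages, each
of which is decoded with error probability at most `ε` and has a codeword that meets the sparsity
rate of the pattern law up to `ε`. -/
def Model.Reliable (M : Model) (n : ℕ) (r : ℝ) : Prop :=
  ∀ ε : ℝ, 0 < ε → ∃ N₀ : ℕ, ∀ N : ℕ, N₀ ≤ N → ∃ C : Code n N,
    (2 : ℝ) ^ ((n : ℝ) * N * r) ≤ C.size ∧
      ∀ m : Fin C.size, C.errorProb M m ≤ ENNReal.ofReal ε ∧
        |C.fractionOfOnes m - M.sparsity n| ≤ ε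

/-- `R` is an achievable rate when only the pattern `S` carries information: every smaller rate
allows reliable communication in arbitrarily large dimensions. -/
def Model.Achievable (M : Model) (R : ℝ) : Prop :=
  ∀ r : ℝ, r < R → ∃ᶠ n : ℕ in atTop, M.Reliable n r

end

end SparseChannel

namespace SparseChannel

noncomputable section

set_option linter.unusedSectionVars false

/-! ### Conditional densities, Gibbs inequalities and mutual information as a difference of mean
log-densities. -/

section Density

/-! All output laws are described by densities with respect to one reference measure, the noise law.
Given `(A, H)` and `X`, the output is Gaussian noise translated by `A H X`, so it has the
Cameron–Martin density `densityX`. Averaging over `U` gives the density given `(A, H, S)`, and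
averaging that over `S` gives the density given `(A, H)`. By `condMutualInfo_eq` each mutual
information is a difference of two mean log-densities. The density depends on `(S, U)` only through
`X`, and averaging over `X` is the same as averaging over `U` and then over `S`
(`marginalDensity_densityX`). So the three informations are differences of the same three numbers
`meanLogX`, `meanLogS`, `meanLog`, and the identity telescopes.

The telescoping needs finite means. Since `E (A H X)_i ^ 2 ≤ σ²` (`memLp_gain_and_integral_sq_le`),
`meanLogX` is finite and at most linear in `n`. The averaged log-densities are controlled through
`log t ≤ t - 1`, applied to ratios of mean one. The same inequality gives `0 ≤ meanLog ≤ meanLogS ≤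
meanLogX`, which bounds both information rates.

In a fixed dimension, patterns are the letters of a finite-input channel with output `(A, H, Y)`.
Feinstein's greedy construction (`channel_coding`) reaches every rate below `I(S; Y | A, H)`, and
the sparsity constraint is built into the typical set. Finally, the difference of two upper limits
is at most the upper limit of the difference, so a rate below `ℐ₁ - ℐ₂` lies below the normalized
information in infinitely many dimensions, and in all large ones if both limits exist. -/

theorem integrable_and_integral_eq_one {Ω : Type*} [MeasurableSpace Ω] {μ : Measure Ω} {f : Ω → ℝ}
    (hf : Measurable f) (hf0 : ∀ ω, 0 ≤ f ω) (hf1 : ∫⁻ ω, ENNReal.ofReal (f ω) ∂μ = 1) :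
    Integrable f μ ∧ ∫ ω, f ω ∂μ = 1 := by
  refine ⟨(lintegral_ofReal_ne_top_iff_integrable hf.aestronglyMeasurable (ae_of_all _ hf0)).1
    (by simp [hf1]), ?_⟩
  rw [integral_eq_lintegral_of_nonneg_ae (ae_of_all _ hf0) hf.aestronglyMeasurable, hf1,
    ENNReal.toReal_one]


variable {Ω α β γ : Type*} [MeasurableSpace Ω] [MeasurableSpace α] [MeasurableSpace β]
  [MeasurableSpace γ]

/-- A family of positive probability densities `k z x` with respect to `ν`, jointly measurable, and
bounded in the parameters `z`, `x` at every point. -/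
structure IsCondDensity (ν : Measure β) (k : γ → α → β → ℝ) : Prop where
  measurable : Measurable fun p : γ × α × β => k p.1 p.2.1 p.2.2
  pos : ∀ z x y, 0 < k z x y
  bounded : ∀ y, ∃ C, ∀ z x, k z x y ≤ C
  lintegral_eq_one : ∀ z x, ∫⁻ y, ENNReal.ofReal (k z x y) ∂ν = 1

/-- The density obtained by averaging over the parameter `x`. -/
def marginalDensity (ρ : Measure α) (k : γ → α → β → ℝ) (z : γ) (y : β) : ℝ := ∫ x, k z x y ∂ρ

namespace IsCondDensity

variable {ν : Measure β} {k : γ → α → β → ℝ} (hk : IsCondDensity ν k)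
  (ρ : Measure α) [IsProbabilityMeasure ρ]

include hk

theorem measurable_left (z : γ) (y : β) : Measurable fun x => k z x y :=
  hk.measurable.comp (by fun_prop : Measurable fun x : α => (z, x, y))

theorem integrable_left (z : γ) (y : β) : Integrable (fun x => k z x y) ρ := by
  obtain ⟨C, hC⟩ := hk.bounded y
  refine Integrable.of_bound (hk.measurable_left z y).aestronglyMeasurable C (ae_of_all _ fun x => ?_)
  rw [Real.norm_of_nonneg (hk.pos z x y).le]
  exact hC z x

theorem ofReal_marginalDensity (z : γ) (y : β) :
    ENNReal.ofReal (marginalDensity ρ k z y) = ∫⁻ x, ENNReal.ofReal (k z x y) ∂ρ :=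
  ofReal_integral_eq_lintegral_ofReal (hk.integrable_left ρ z y)
    (ae_of_all _ fun x => (hk.pos z x y).le)

theorem marginalDensity_pos (z : γ) (y : β) : 0 < marginalDensity ρ k z y := by
  refine (integral_pos_iff_support_of_nonneg (fun x => (hk.pos z x y).le)
    (hk.integrable_left ρ z y)).2 ?_
  have : Function.support (fun x => k z x y) = Set.univ :=
    Set.eq_univ_of_forall fun x => (hk.pos z x y).ne'
  rw [this, measure_univ]
  exact one_pos

theorem marginalDensity_bounded (y : β) : ∃ C, ∀ z, marginalDensity ρ k z y ≤ C := by
  obtain ⟨C, hC⟩ := hk.bounded y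
  refine ⟨C, fun z => ?_⟩
  calc marginalDensity ρ k z y ≤ ∫ _, C ∂ρ :=
        integral_mono (hk.integrable_left ρ z y) (integrable_const _) fun x => hC z x
    _ = C := by simp

theorem measurable_marginalDensity :
    Measurable fun p : γ × β => marginalDensity ρ k p.1 p.2 := by
  have h : Measurable fun q : (γ × β) × α => k q.1.1 q.2 q.1.2 :=
    hk.measurable.comp (by fun_prop : Measurable fun q : (γ × β) × α => (q.1.1, q.2, q.1.2))
  exact (h.stronglyMeasurable.integral_prod_right' (ν := ρ)).measurable

theorem lintegral_marginalDensity [SFinite ν] (z : γ) :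
    ∫⁻ y, ENNReal.ofReal (marginalDensity ρ k z y) ∂ν = 1 := by
  simp_rw [hk.ofReal_marginalDensity ρ]
  rw [lintegral_lintegral_swap]
  · simp [hk.lintegral_eq_one]
  · exact (hk.measurable.comp
      (by fun_prop : Measurable fun q : β × α => (z, q.2, q.1))).ennreal_ofReal.aemeasurable

/-- This is `log t ≤ t - 1` for the ratio of the averaged density to the original one. That ratio
has mean one under the joint law, so the inequality yields both an integrable majorant and, after
integration, Gibbs' inequality. -/
theorem log_marginal_le (z : γ) (x : α) (y : β) :
    Real.log (marginalDensity ρ k z y) ≤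
      Real.log (k z x y) + (marginalDensity ρ k z y / k z x y - 1) := by
  have h1 := Real.log_le_sub_one_of_pos (div_pos (hk.marginalDensity_pos ρ z y) (hk.pos z x y))
  rw [Real.log_div (hk.marginalDensity_pos ρ z y).ne' (hk.pos z x y).ne'] at h1
  linarith

/-- The lower counterpart: the reciprocal of the averaged density has mean one under the law of `(Z,
Y)` when `ν` is a probability measure. -/
theorem le_log_marginal (z : γ) (y : β) :
    1 - (marginalDensity ρ k z y)⁻¹ ≤ Real.log (marginalDensity ρ k z y) := by
  have h1 := Real.log_le_sub_one_of_pos (inv_pos.2 (hk.marginalDensity_pos ρ z y))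
  rw [Real.log_inv] at h1
  linarith

end IsCondDensity

/-- `Z` and `X` are independent with laws `P` and `ρ`, and given them `Y` has density `k` with
respect to `ν`. -/
structure HasCondDensity (μ : Measure Ω) (X : Ω → α) (Y : Ω → β) (Z : Ω → γ) (P : Measure γ)
    (ρ : Measure α) (ν : Measure β) (k : γ → α → β → ℝ) : Prop where
  measurable_X : Measurable X
  measurable_Y : Measurable Y
  measurable_Z : Measurable Z
  map_eq : μ.map (fun ω => (Z ω, X ω, Y ω)) =
    (P.prod (ρ.prod ν)).withDensity fun p => ENNReal.ofReal (k p.1 p.2.1 p.2.2)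

namespace HasCondDensity

variable {μ : Measure Ω} {X : Ω → α} {Y : Ω → β} {Z : Ω → γ} {P : Measure γ} {ρ : Measure α}
  {ν : Measure β} {k : γ → α → β → ℝ} [IsProbabilityMeasure μ] [IsProbabilityMeasure P]
  [IsProbabilityMeasure ρ] [IsProbabilityMeasure ν]
  (h : HasCondDensity μ X Y Z P ρ ν k) (hk : IsCondDensity ν k)

include h hk

theorem lintegral_eq {F : γ × α × β → ℝ≥0∞} (hF : Measurable F) :
    ∫⁻ ω, F (Z ω, X ω, Y ω) ∂μ =
      ∫⁻ z, ∫⁻ x, ∫⁻ y, ENNReal.ofReal (k z x y) * F (z, x, y) ∂ν ∂ρ ∂P := by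
  have hm : Measurable fun ω => (Z ω, X ω, Y ω) :=
    h.measurable_Z.prodMk (h.measurable_X.prodMk h.measurable_Y)
  have hkF : Measurable fun p : γ × α × β => ENNReal.ofReal (k p.1 p.2.1 p.2.2) * F p :=
    hk.measurable.ennreal_ofReal.mul hF
  rw [← lintegral_map (f := F) hF hm, h.map_eq,
    lintegral_withDensity_eq_lintegral_mul _ hk.measurable.ennreal_ofReal hF]
  simp only [Pi.mul_apply]
  rw [lintegral_prod _ hkF.aemeasurable]
  refine lintegral_congr fun z => ?_
  exact lintegral_prod (fun q : α × β => ENNReal.ofReal (k z q.1 q.2) * F (z, q))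
    (hkF.comp (by fun_prop : Measurable fun q : α × β => (z, q))).aemeasurable

theorem map_ZX : μ.map (fun ω => (Z ω, X ω)) = P.prod ρ := by
  refine Measure.ext_of_lintegral _ fun f hf => ?_
  rw [lintegral_map hf (h.measurable_Z.prodMk h.measurable_X),
    h.lintegral_eq hk (F := fun p => f (p.1, p.2.1)) (by fun_prop), lintegral_prod _ hf.aemeasurable]
  refine lintegral_congr fun z => lintegral_congr fun x => ?_
  have hy : Measurable fun y => ENNReal.ofReal (k z x y) :=
    (hk.measurable.comp (by fun_prop : Measurable fun y : β => (z, x, y))).ennreal_ofReal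
  simp only
  rw [lintegral_mul_const _ hy, hk.lintegral_eq_one, one_mul]

theorem map_Z : μ.map Z = P := by
  have := congrArg (Measure.map Prod.fst) (h.map_ZX hk)
  rwa [Measure.map_map measurable_fst (h.measurable_Z.prodMk h.measurable_X), Measure.map_fst_prod,
    measure_univ, one_smul] at this

theorem lintegral_ZY {F : γ × β → ℝ≥0∞} (hF : Measurable F) :
    ∫⁻ ω, F (Z ω, Y ω) ∂μ =
      ∫⁻ z, ∫⁻ y, ENNReal.ofReal (marginalDensity ρ k z y) * F (z, y) ∂ν ∂P := by
  rw [h.lintegral_eq hk (F := fun p => F (p.1, p.2.2)) (by fun_prop)]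
  refine lintegral_congr fun z => ?_
  have hm : Measurable fun q : α × β => ENNReal.ofReal (k z q.1 q.2) :=
    (hk.measurable.comp (by fun_prop : Measurable fun q : α × β => (z, q.1, q.2))).ennreal_ofReal
  rw [lintegral_lintegral_swap]
  · refine lintegral_congr fun y => ?_
    simp only
    rw [lintegral_mul_const _ (hk.measurable_left z y).ennreal_ofReal, hk.ofReal_marginalDensity ρ]
  · exact (hm.mul (hF.comp (by fun_prop : Measurable fun q : α × β => (z, q.2)))).aemeasurable

theorem map_ZY : μ.map (fun ω => (Z ω, Y ω)) =
    (P.prod ν).withDensity fun p => ENNReal.ofReal (marginalDensity ρ k p.1 p.2) := by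
  have hm := (hk.measurable_marginalDensity ρ).ennreal_ofReal
  refine Measure.ext_of_lintegral _ fun f hf => ?_
  rw [lintegral_map hf (h.measurable_Z.prodMk h.measurable_Y), h.lintegral_ZY hk hf,
    lintegral_withDensity_eq_lintegral_mul _ hm hf, lintegral_prod _ (hm.mul hf).aemeasurable]
  rfl

theorem lintegral_inv_marginalDensity :
    ∫⁻ ω, ENNReal.ofReal (marginalDensity ρ k (Z ω) (Y ω))⁻¹ ∂μ = 1 := by
  rw [h.lintegral_ZY hk (F := fun p => ENNReal.ofReal (marginalDensity ρ k p.1 p.2)⁻¹)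
    (hk.measurable_marginalDensity ρ).inv.ennreal_ofReal]
  simp_rw [← ENNReal.ofReal_mul (hk.marginalDensity_pos ρ _ _).le,
    mul_inv_cancel₀ (hk.marginalDensity_pos ρ _ _).ne']
  simp

theorem lintegral_marginalDensity_div :
    ∫⁻ ω, ENNReal.ofReal (marginalDensity ρ k (Z ω) (Y ω) / k (Z ω) (X ω) (Y ω)) ∂μ = 1 := by
  have hm : Measurable fun p : γ × α × β => marginalDensity ρ k p.1 p.2.2 :=
    (hk.measurable_marginalDensity ρ).comp (by fun_prop : Measurable fun p : γ × α × β => (p.1, p.2.2))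
  rw [h.lintegral_eq hk
    (F := fun p => ENNReal.ofReal (marginalDensity ρ k p.1 p.2.2 / k p.1 p.2.1 p.2.2))
    (hm.div hk.measurable).ennreal_ofReal]
  simp_rw [← ENNReal.ofReal_mul (hk.pos _ _ _).le, mul_div_cancel₀ _ (hk.pos _ _ _).ne',
    hk.lintegral_marginalDensity ρ]
  simp

/-- For an input `x` fixed independently of the output, the denominator cancels the output density
and leaves the total mass of `k z x`. In the coding theorem this is the exponential moment that
limits false acceptance. -/
theorem lintegral_div_marginalDensity (x : α) :
    ∫⁻ ω, ENNReal.ofReal (k (Z ω) x (Y ω) / marginalDensity ρ k (Z ω) (Y ω)) ∂μ = 1 := by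
  have hm : Measurable fun p : γ × β => k p.1 x p.2 :=
    hk.measurable.comp (by fun_prop : Measurable fun p : γ × β => (p.1, x, p.2))
  rw [h.lintegral_ZY hk (F := fun p => ENNReal.ofReal (k p.1 x p.2 / marginalDensity ρ k p.1 p.2))
    (hm.div (hk.measurable_marginalDensity ρ)).ennreal_ofReal]
  simp_rw [← ENNReal.ofReal_mul (hk.marginalDensity_pos ρ _ _).le,
    mul_div_cancel₀ _ (hk.marginalDensity_pos ρ _ _).ne', hk.lintegral_eq_one]
  simp

theorem measurable_density : Measurable fun ω => k (Z ω) (X ω) (Y ω) :=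
  hk.measurable.comp (h.measurable_Z.prodMk (h.measurable_X.prodMk h.measurable_Y))

theorem measurable_marginal : Measurable fun ω => marginalDensity ρ k (Z ω) (Y ω) :=
  (hk.measurable_marginalDensity ρ).comp (h.measurable_Z.prodMk h.measurable_Y)

theorem integrable_inv_marginal :
    Integrable (fun ω => (marginalDensity ρ k (Z ω) (Y ω))⁻¹) μ ∧
      ∫ ω, (marginalDensity ρ k (Z ω) (Y ω))⁻¹ ∂μ = 1 :=
  integrable_and_integral_eq_one (h.measurable_marginal hk).inv
    (fun _ => (inv_pos.2 (hk.marginalDensity_pos ρ _ _)).le) (h.lintegral_inv_marginalDensity hk)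

theorem integrable_marginal_div :
    Integrable (fun ω => marginalDensity ρ k (Z ω) (Y ω) / k (Z ω) (X ω) (Y ω)) μ ∧
      ∫ ω, marginalDensity ρ k (Z ω) (Y ω) / k (Z ω) (X ω) (Y ω) ∂μ = 1 :=
  integrable_and_integral_eq_one ((h.measurable_marginal hk).div (h.measurable_density hk))
    (fun _ => (div_pos (hk.marginalDensity_pos ρ _ _) (hk.pos _ _ _)).le)
    (h.lintegral_marginalDensity_div hk)

variable (hlog : Integrable (fun ω => Real.log (k (Z ω) (X ω) (Y ω))) μ)
include hlog

theorem integrable_log_marginal :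
    Integrable (fun ω => Real.log (marginalDensity ρ k (Z ω) (Y ω))) μ :=
  integrable_of_le_of_le (h.measurable_marginal hk).log.aestronglyMeasurable
    (ae_of_all _ fun ω => hk.le_log_marginal ρ (Z ω) (Y ω))
    (ae_of_all _ fun ω => hk.log_marginal_le ρ (Z ω) (X ω) (Y ω))
    ((integrable_const _).sub (h.integrable_inv_marginal hk).1)
    (hlog.add ((h.integrable_marginal_div hk).1.sub (integrable_const _)))

/-- The integral is the relative entropy of the law of `(Z, Y)` with respect to `P.prod ν`.
Nonnegativity follows by integrating `le_log_marginal`. -/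
theorem integral_log_marginal_nonneg :
    0 ≤ ∫ ω, Real.log (marginalDensity ρ k (Z ω) (Y ω)) ∂μ := by
  have h1 := integral_mono ((integrable_const _).sub (h.integrable_inv_marginal hk).1)
    (h.integrable_log_marginal hk hlog) fun ω => hk.le_log_marginal ρ (Z ω) (Y ω)
  refine le_trans (le_of_eq ?_) h1
  simp [integral_sub (integrable_const _) (h.integrable_inv_marginal hk).1,
    (h.integrable_inv_marginal hk).2]

theorem integral_log_marginal_le :
    ∫ ω, Real.log (marginalDensity ρ k (Z ω) (Y ω)) ∂μ ≤ ∫ ω, Real.log (k (Z ω) (X ω) (Y ω)) ∂μ := by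
  have hd := h.integrable_marginal_div hk
  have h1 := integral_mono (h.integrable_log_marginal hk hlog)
    (hlog.add (hd.1.sub (integrable_const _))) fun ω => hk.log_marginal_le ρ (Z ω) (X ω) (Y ω)
  refine h1.trans (le_of_eq ?_)
  rw [integral_add' hlog (hd.1.sub (integrable_const _)), integral_sub' hd.1 (integrable_const _),
    hd.2]
  simp

/-- Since `X` is independent of `Z`, its conditional law is constant, while that of `Y` has the
averaged density. The conditionally independent law `Q` is therefore explicit, the joint law has
density `k` over the averaged density with respect to `Q`, and the divergence is the mean logarithm
of this ratio. -/
theorem condMutualInfo_eq [StandardBorelSpace α] [Nonempty α] [StandardBorelSpace β] [Nonempty β] :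
    condMutualInfo μ X Y Z =
      ENNReal.ofReal (∫ ω, Real.log (k (Z ω) (X ω) (Y ω)) ∂μ -
        ∫ ω, Real.log (marginalDensity ρ k (Z ω) (Y ω)) ∂μ) / ENNReal.ofReal (Real.log 2) := by
  have hmk := hk.measurable_marginalDensity ρ
  have hZX : Measurable fun ω => (Z ω, X ω, Y ω) :=
    h.measurable_Z.prodMk (h.measurable_X.prodMk h.measurable_Y)
  -- the conditional laws
  have hX : condDistrib X Z μ =ᵐ[μ.map Z] Kernel.const γ ρ := by
    refine condDistrib_ae_eq_of_measure_eq_compProd_of_measurable h.measurable_Z h.measurable_X ?_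
    rw [h.map_ZX hk, h.map_Z hk, Measure.compProd_const]
  have hmu : Measurable (Function.uncurry fun z y => ENNReal.ofReal (marginalDensity ρ k z y)) :=
    hmk.ennreal_ofReal
  let κ : Kernel γ β :=
    (Kernel.const γ ν).withDensity fun z y => ENNReal.ofReal (marginalDensity ρ k z y)
  have hκ_apply : ∀ z, κ z = ν.withDensity fun y => ENNReal.ofReal (marginalDensity ρ k z y) :=
    fun z => by rw [Kernel.withDensity_apply _ hmu, Kernel.const_apply]
  have hκ : IsMarkovKernel κ := ⟨fun z => ⟨by
    rw [hκ_apply, withDensity_apply _ .univ, setLIntegral_univ, hk.lintegral_marginalDensity ρ]⟩⟩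
  have hY : condDistrib Y Z μ =ᵐ[μ.map Z] κ := by
    refine condDistrib_ae_eq_of_measure_eq_compProd_of_measurable h.measurable_Z h.measurable_Y ?_
    rw [h.map_ZY hk, h.map_Z hk, Measure.compProd_withDensity hmu, Measure.compProd_const]
  set Q := (P.prod (ρ.prod ν)).withDensity
    fun p => ENNReal.ofReal (marginalDensity ρ k p.1 p.2.2) with hQ
  have hmQ : Measurable fun p : γ × α × β => ENNReal.ofReal (marginalDensity ρ k p.1 p.2.2) :=
    hmk.ennreal_ofReal.comp (by fun_prop : Measurable fun p : γ × α × β => (p.1, p.2.2))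
  have hprod : (μ.map Z) ⊗ₘ ((condDistrib X Z μ) ×ₖ (condDistrib Y Z μ)) = Q := by
    have h1 : (μ.map Z) ⊗ₘ ((condDistrib X Z μ) ×ₖ (condDistrib Y Z μ)) =
        (μ.map Z) ⊗ₘ (Kernel.const γ ρ ×ₖ κ) := by
      refine Measure.compProd_congr ?_
      filter_upwards [hX, hY] with z h1 h2
      rw [Kernel.prod_apply, Kernel.prod_apply, h1, h2]
    rw [h1, h.map_Z hk]
    refine Measure.ext_of_lintegral _ fun f hf => ?_
    rw [Measure.lintegral_compProd hf, lintegral_withDensity_eq_lintegral_mul _ hmQ hf,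
      lintegral_prod _ (hmQ.mul hf).aemeasurable]
    refine lintegral_congr fun z => ?_
    have hz : Measurable fun q : α × β => f (z, q) := by fun_prop
    have hzy : Measurable fun y => ENNReal.ofReal (marginalDensity ρ k z y) :=
      hmu.comp (by fun_prop : Measurable fun y : β => (z, y))
    have hzq : Measurable fun q : α × β => ENNReal.ofReal (marginalDensity ρ k z q.2) :=
      hzy.comp measurable_snd
    rw [Kernel.prod_apply, Kernel.const_apply, hκ_apply,
      prod_withDensity_right hzy, lintegral_withDensity_eq_lintegral_mul _
        hzq hz]
    rfl
  -- the density of the joint law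
  let r : γ × α × β → ℝ≥0∞ := fun p =>
    ENNReal.ofReal (k p.1 p.2.1 p.2.2 / marginalDensity ρ k p.1 p.2.2)
  have hr : Measurable r := (hk.measurable.div
    (hmk.comp (by fun_prop : Measurable fun p : γ × α × β => (p.1, p.2.2)))).ennreal_ofReal
  have hJ : μ.map (fun ω => (Z ω, X ω, Y ω)) = Q.withDensity r := by
    rw [h.map_eq, hQ, ← withDensity_mul _ hmQ hr]
    congr 1
    funext p
    simp only [Pi.mul_apply, r]
    rw [← ENNReal.ofReal_mul (hk.marginalDensity_pos ρ _ _).le,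
      mul_div_cancel₀ _ (hk.marginalDensity_pos ρ _ _).ne']
  have : IsProbabilityMeasure Q := by
    have := Measure.isProbabilityMeasure_map (μ := μ) h.measurable_Z.aemeasurable
    rw [← hprod]
    infer_instance
  have : IsProbabilityMeasure (μ.map fun ω => (Z ω, X ω, Y ω)) :=
    Measure.isProbabilityMeasure_map hZX.aemeasurable
  have hac : μ.map (fun ω => (Z ω, X ω, Y ω)) ≪ Q := by
    rw [hJ]; exact withDensity_absolutelyContinuous _ _
  have hllr : llr (μ.map fun ω => (Z ω, X ω, Y ω)) Q =ᵐ[μ.map fun ω => (Z ω, X ω, Y ω)]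
      fun p => Real.log (k p.1 p.2.1 p.2.2) - Real.log (marginalDensity ρ k p.1 p.2.2) := by
    have h1 : (μ.map fun ω => (Z ω, X ω, Y ω)).rnDeriv Q =ᵐ[Q] r := by
      rw [hJ]; exact Measure.rnDeriv_withDensity Q hr
    filter_upwards [hac.ae_le h1] with p hp
    rw [llr, hp, ENNReal.toReal_ofReal (div_pos (hk.pos _ _ _) (hk.marginalDensity_pos ρ _ _)).le,
      Real.log_div (hk.pos _ _ _).ne' (hk.marginalDensity_pos ρ _ _).ne']
  have hmF : AEStronglyMeasurable
      (fun p : γ × α × β => Real.log (k p.1 p.2.1 p.2.2) - Real.log (marginalDensity ρ k p.1 p.2.2))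
      (μ.map fun ω => (Z ω, X ω, Y ω)) := by
    refine (hk.measurable.log.sub (Measurable.log ?_)).aestronglyMeasurable
    exact hmk.comp (by fun_prop : Measurable fun p : γ × α × β => (p.1, p.2.2))
  have hint : Integrable (llr (μ.map fun ω => (Z ω, X ω, Y ω)) Q)
      (μ.map fun ω => (Z ω, X ω, Y ω)) := by
    rw [integrable_congr hllr, integrable_map_measure hmF hZX.aemeasurable]
    exact hlog.sub (h.integrable_log_marginal hk hlog)
  rw [condMutualInfo, hprod, InformationTheory.klDiv_of_ac_of_integrable hac hint,
    integral_congr_ae hllr, integral_map hZX.aemeasurable hmF,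
    integral_sub hlog (h.integrable_log_marginal hk hlog)]
  -- Both measures have mass one, so the mass correction in `klDiv` vanishes.
  simp

end HasCondDensity
end Density

/-! ### Feinstein's lemma and the channel coding theorem. -/

section Coding

/-- Greedy selection of codewords `x i` with disjoint decoding regions `D i` (Feinstein). -/
theorem exists_disjoint_decoding_sets {A B : Type*} [Fintype A] [Nonempty A] [MeasurableSpace B]
    (w : A → ℝ≥0∞) (hw : ∑ x, w x = 1) (W : A → Measure B) (E : A → Set B)
    (hE : ∀ x, MeasurableSet (E x)) (θ c : ℝ≥0∞) (hθ : ∀ x, (∑ x', w x' • W x') (E x) ≤ θ)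
    (M : ℕ) (hM : ∀ m < M, m * θ + c < ∑ x, w x * W x (E x)) :
    ∃ (x : ℕ → A) (D : ℕ → Set B), ∀ i < M, MeasurableSet (D i) ∧ D i ⊆ E (x i) ∧
      c ≤ W (x i) (D i) ∧ ∀ j < i, Disjoint (D j) (D i) := by
  induction M with
  | zero => exact ⟨fun _ => Classical.arbitrary A, fun _ => ∅, fun i hi => absurd hi (by omega)⟩
  | succ M ih =>
    obtain ⟨x, D, h⟩ := ih fun m hm => hM m (by omega)
    set U : Set B := ⋃ i ∈ Finset.range M, D i with hU
    have hUm : MeasurableSet U :=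
      Finset.measurableSet_biUnion _ fun i hi => (h i (Finset.mem_range.1 hi)).1
    -- Each earlier region lies in some acceptance set, whose mass under the output law is at most
    -- `θ`.
    have hQU : ∑ x', w x' * W x' U ≤ M * θ := by
      have h1 : (∑ x', w x' • W x') U ≤ ∑ i ∈ Finset.range M, (∑ x', w x' • W x') (D i) :=
        measure_biUnion_finset_le _ _
      have h2 : ∑ i ∈ Finset.range M, (∑ x', w x' • W x') (D i) ≤ ∑ i ∈ Finset.range M, θ :=
        Finset.sum_le_sum fun i hi =>
          (measure_mono (h i (Finset.mem_range.1 hi)).2.1).trans (hθ _)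
      simpa using h1.trans h2
    -- If no input worked, averaging over `w` would bound the mean acceptance probability by `M * θ
    -- + c`, against `hM`.
    obtain ⟨a, ha⟩ : ∃ a, c ≤ W a (E a \ U) := by
      by_contra! hc
      refine (hM M (by omega)).not_ge ?_
      calc ∑ a, w a * W a (E a) ≤ ∑ a, (w a * W a U + w a * c) := by
            refine Finset.sum_le_sum fun a _ => ?_
            rw [← mul_add]
            gcongr
            calc W a (E a) ≤ W a (U ∪ E a \ U) := measure_mono (by intro b; by_cases b ∈ U <;> simp_all)
              _ ≤ W a U + W a (E a \ U) := measure_union_le _ _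
              _ ≤ W a U + c := by gcongr; exact (hc a).le
        _ = ∑ a, w a * W a U + c := by rw [Finset.sum_add_distrib, ← Finset.sum_mul, hw, one_mul]
        _ ≤ M * θ + c := by gcongr
    refine ⟨Function.update x M a, Function.update D M (E a \ U), fun i hi => ?_⟩
    rcases Nat.lt_succ_iff_lt_or_eq.1 hi with hi | rfl
    · rw [Function.update_of_ne hi.ne, Function.update_of_ne hi.ne]
      refine ⟨(h i hi).1, (h i hi).2.1, (h i hi).2.2.1, fun j hj => ?_⟩
      rw [Function.update_of_ne (hj.trans hi).ne]
      exact (h i hi).2.2.2 j hj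
    · simp only [Function.update_self]
      refine ⟨(hE a).diff hUm, Set.sdiff_subset, ha, fun j hj => ?_⟩
      rw [Function.update_of_ne hj.ne]
      exact Set.disjoint_left.2 fun b hb hb' =>
        hb'.2 (Set.mem_biUnion (Finset.mem_range.2 hj) hb)

theorem exists_measurable_decoder {B : Type*} [MeasurableSpace B] {M : ℕ} (hM : 0 < M)
    (D : Fin M → Set B) (hD : ∀ i, MeasurableSet (D i)) (hdis : ∀ i j, j < i → Disjoint (D j) (D i)) :
    ∃ decode : B → Fin M, Measurable decode ∧ ∀ i, ∀ b ∈ D i, decode b = i := by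
  classical
  have huniq : ∀ b i j, b ∈ D i → b ∈ D j → i = j := by
    intro b i j hi hj
    rcases lt_trichotomy i j with h | h | h
    · exact absurd hj (Set.disjoint_left.1 (hdis j i h) hi)
    · exact h
    · exact absurd hi (Set.disjoint_left.1 (hdis i j h) hj)
  let dec : B → Fin M := fun b => if h : ∃ i, b ∈ D i then h.choose else ⟨0, hM⟩
  have hdec : ∀ i, ∀ b ∈ D i, dec b = i := by
    intro i b hb
    have h : ∃ i, b ∈ D i := ⟨i, hb⟩
    simp only [dec, dif_pos h]
    exact huniq b _ _ h.choose_spec hb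
  refine ⟨dec, measurable_to_countable' fun i => ?_, hdec⟩
  -- The last set is everything or empty: observations outside all regions are sent to message `0`
  -- by default.
  have : dec ⁻¹' {i} = D i ∪ ((⋃ j, D j)ᶜ ∩ {_b | i = ⟨0, hM⟩}) := by
    ext b
    by_cases h : ∃ j, b ∈ D j
    · obtain ⟨j, hj⟩ := h
      have : b ∈ ⋃ j, D j := Set.mem_iUnion.2 ⟨j, hj⟩
      simp only [Set.mem_preimage, Set.mem_singleton_iff, hdec j b hj, Set.mem_union,
        Set.mem_inter_iff, Set.mem_compl_iff, this, not_true, false_and, or_false]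
      exact ⟨fun h => h ▸ hj, fun h => huniq b j i hj h⟩
    · have h1 : b ∉ ⋃ j, D j := fun hb => h (Set.mem_iUnion.1 hb)
      have h2 : b ∉ D i := fun hb => h ⟨i, hb⟩
      simp only [Set.mem_preimage, Set.mem_singleton_iff, dec, dif_neg h, Set.mem_union, h2,
        false_or, Set.mem_inter_iff, Set.mem_compl_iff, h1, not_false_iff, true_and,
        Set.mem_ofPred_eq]
      exact eq_comm
  rw [this]
  exact (hD i).union ((MeasurableSet.iUnion hD).compl.inter (MeasurableSet.const _))

theorem pi_sum_smul {S O : Type*} [Fintype S] [MeasurableSpace O] (w : S → ℝ≥0∞)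
    (hw : ∑ s, w s = 1) (κ : S → Measure O) [∀ s, IsProbabilityMeasure (κ s)] (N : ℕ) :
    Measure.pi (fun _ : Fin N => ∑ s, w s • κ s) =
      ∑ x : Fin N → S, (∏ t, w (x t)) • Measure.pi (fun t => κ (x t)) := by
  classical
  have : IsProbabilityMeasure (∑ s, w s • κ s) := ⟨by simp [hw]⟩
  refine Measure.pi_eq fun T hT => ?_
  simp only [Measure.coe_finsetSum, Finset.sum_apply, Measure.smul_apply, smul_eq_mul,
    Measure.pi_pi]
  rw [Finset.prod_univ_sum, Fintype.piFinset_univ]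
  simp_rw [Finset.prod_mul_distrib]

/-- The joint law of the input and the output of a channel `W` with input weights `w`. -/
def jointMeasure {S O : Type*} [Fintype S] [MeasurableSpace S] [MeasurableSpace O]
    (w : S → ℝ≥0∞) (W : S → Measure O) : Measure (S × O) :=
  ∑ s, w s • (Measure.dirac s).prod (W s)

variable {S O : Type*} [Fintype S] [MeasurableSpace S] [MeasurableSpace O] {w : S → ℝ≥0∞}
  {W : S → Measure O} [∀ s, IsProbabilityMeasure (W s)]

theorem isProbabilityMeasure_jointMeasure (hw : ∑ s, w s = 1) :
    IsProbabilityMeasure (jointMeasure w W) := ⟨by simp [jointMeasure, hw]⟩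

/-- Under i.i.d. inputs, the probability of `T` is the average over codewords of the probability of
the slice of `T`. This turns a law of large numbers for the joint law into the averaged hypothesis
of `exists_disjoint_decoding_sets`. -/
theorem pi_jointMeasure_apply (hw : ∑ s, w s = 1) {N : ℕ} {T : Set (Fin N → S × O)}
    (hT : MeasurableSet T) :
    Measure.pi (fun _ : Fin N => jointMeasure w W) T =
      ∑ x : Fin N → S, (∏ t, w (x t)) *
        Measure.pi (fun t => W (x t)) {o | (fun t => (x t, o t)) ∈ T} := by
  unfold jointMeasure
  rw [pi_sum_smul w hw fun s => (Measure.dirac s).prod (W s)]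
  simp only [Measure.coe_finsetSum, Finset.sum_apply, Measure.smul_apply, smul_eq_mul]
  refine Finset.sum_congr rfl fun x _ => ?_
  congr 1
  have h1 : ∀ t, (Measure.dirac (x t)).prod (W (x t)) = (W (x t)).map (Prod.mk (x t)) :=
    fun t => Measure.dirac_prod _
  have : ∀ t, IsProbabilityMeasure ((W (x t)).map (Prod.mk (x t))) := fun t =>
    Measure.isProbabilityMeasure_map measurable_prodMk_left.aemeasurable
  simp_rw [h1]
  rw [← Measure.pi_map_pi fun t => measurable_prodMk_left.aemeasurable, Measure.map_apply _ hT]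
  · rfl
  · exact measurable_pi_lambda _ fun t => measurable_prodMk_left.comp (measurable_pi_apply t)

omit [Fintype S] in
/-- The weak law of large numbers on finite powers of a probability space. -/
theorem tendsto_pi_real_abs_sub_ge {A : Type*} [MeasurableSpace A] (J : Measure A)
    [IsProbabilityMeasure J] {f : A → ℝ} (hf : Measurable f) (hint : Integrable f J) {δ : ℝ}
    (hδ : 0 < δ) :
    Tendsto (fun N : ℕ => (Measure.pi fun _ : Fin N => J).real
      {a | δ ≤ |(∑ t, f (a t)) / N - ∫ a, f a ∂J|}) atTop (𝓝 0) := by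
  -- The strong law needs one space for all `N`. The finite powers are recovered below as the laws
  -- of the first `N` coordinates.
  let P : Measure (ℕ → A) := Measure.infinitePi fun _ => J
  let X : ℕ → (ℕ → A) → ℝ := fun t a => f (a t)
  have hmap : ∀ t : ℕ, P.map (fun a : ℕ → A => a t) = J := fun t =>
    (measurePreserving_eval_infinitePi (fun _ => J) t).map_eq
  have hI : iIndepFun X P := iIndepFun_infinitePi fun _ => hf
  have hX0 : Integrable (X 0) P :=
    (measurePreserving_eval_infinitePi (fun _ => J) 0).integrable_comp_of_integrable hint
  have hid : ∀ t, IdentDistrib (X t) (X 0) P P := by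
    intro t
    refine ⟨by fun_prop, by fun_prop, ?_⟩
    change P.map (f ∘ fun a : ℕ → A => a t) = P.map (f ∘ fun a : ℕ → A => a 0)
    rw [← Measure.map_map hf (by fun_prop), ← Measure.map_map hf (by fun_prop), hmap, hmap]
  have hmean : ∫ a, X 0 a ∂P = ∫ a, f a ∂J := by
    rw [← hmap 0, integral_map (measurable_pi_apply 0).aemeasurable hf.aestronglyMeasurable]
  have hslln := strong_law_ae_real X hX0 (fun i j hij => hI.indepFun hij) hid
  rw [hmean] at hslln
  have hmeas : ∀ N : ℕ, Measurable fun a : ℕ → A => (∑ t ∈ Finset.range N, X t a) / (N : ℝ) := by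
    intro N; fun_prop
  have htm := tendstoInMeasure_of_tendsto_ae (fun N => (hmeas N).aestronglyMeasurable) hslln
  rw [tendstoInMeasure_iff_dist] at htm
  have h0 := (ENNReal.tendsto_toReal ENNReal.zero_ne_top).comp (htm δ hδ)
  rw [ENNReal.toReal_zero] at h0
  refine h0.congr fun N => ?_
  have hpi : P.map (fun (a : ℕ → A) (t : Fin N) => a t) = Measure.pi fun _ : Fin N => J := by
    have hi : iIndepFun (fun (t : ℕ) (a : ℕ → A) => a t) P :=
      iIndepFun_infinitePi (X := fun _ a => a) fun _ => measurable_id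
    have hi' := hi.precomp (g := fun t : Fin N => (t : ℕ)) Fin.val_injective
    have hi2 := (iIndepFun_iff_map_fun_eq_pi_map (f := fun (t : Fin N) (a : ℕ → A) => a t)
      fun t => (measurable_pi_apply (t : ℕ)).aemeasurable).1 hi'
    rw [hi2]
    simp only [hmap]
  have hs : MeasurableSet {a : Fin N → A | δ ≤ |(∑ t, f (a t)) / N - ∫ a, f a ∂J|} :=
    measurableSet_le measurable_const (by fun_prop)
  rw [measureReal_def, ← hpi, Measure.map_apply (by fun_prop) hs]
  simp only [Function.comp, Real.dist_eq, X, Finset.sum_range]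
  rfl

/-- **Channel coding theorem** for a channel with finitely many inputs: `i` is an information
density, and every codeword meets the average cost of the input law up to `ε`. -/
theorem channel_coding [MeasurableSingletonClass S] (hw : ∑ s, w s = 1) {i : S × O → ℝ}
    (hi : Measurable i) (hint : Integrable i (jointMeasure w W))
    (hexp : ∀ s, ∫⁻ o, ENNReal.ofReal (Real.exp (i (s, o))) ∂(∑ s, w s • W s) ≤ 1)
    (c : S → ℝ) {R ε : ℝ} (hR : R < ∫ p, i p ∂(jointMeasure w W)) (hε : 0 < ε) :
    ∃ N₀ : ℕ, ∀ N : ℕ, N₀ ≤ N → ∃ (M : ℕ) (encode : Fin M → Fin N → S)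
      (decode : (Fin N → O) → Fin M), Measurable decode ∧ Real.exp (N * R) ≤ M ∧ ∀ m,
        Measure.pi (fun t => W (encode m t)) {o | decode o ≠ m} ≤ ENNReal.ofReal ε ∧
        |(∑ t, c (encode m t)) / N - ∫ p, c p.1 ∂(jointMeasure w W)| ≤ ε := by
  have := isProbabilityMeasure_jointMeasure (W := W) hw
  have hne : Nonempty S := by
    by_contra h
    rw [not_nonempty_iff] at h
    simp at hw
  have : IsProbabilityMeasure (∑ s, w s • W s) := ⟨by simp [hw]⟩
  set J := jointMeasure w W with hJ
  set I := ∫ p, i p ∂J with hI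
  set g := (R + I) / 2 with hg
  have hcm : Measurable fun p : S × O => c p.1 := (measurable_of_finite c).comp measurable_fst
  have hcint : Integrable (fun p : S × O => c p.1) J := by
    obtain ⟨K, hK⟩ := (Set.finite_range fun s => |c s|).bddAbove
    exact Integrable.of_bound hcm.aestronglyMeasurable K
      (ae_of_all _ fun p => hK ⟨p.1, rfl⟩)
  set cbar := ∫ p, c p.1 ∂J with hcbar
  -- The cap at `1 / 2` keeps the success probability `1 - e` positive even for large `ε`, so
  -- decoding regions are nonempty.
  set e := min ε (1 / 2) with he
  have he0 : 0 < e := by positivity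
  have heε : e ≤ ε := min_le_left _ _
  have he2 : e ≤ 1 / 2 := min_le_right _ _
  -- the three error terms vanish
  have hlim1 := tendsto_pi_real_abs_sub_ge J hi hint (δ := I - g) (by rw [hg]; linarith)
  have hlim2 := tendsto_pi_real_abs_sub_ge J hcm hcint hε
  have hlim3 : Tendsto (fun N : ℕ => Real.exp (N * (R - g))) atTop (𝓝 0) := by
    refine Real.tendsto_exp_atBot.comp ?_
    exact tendsto_natCast_atTop_atTop.atTop_mul_const_of_neg (by rw [hg]; linarith)
  have hlim := (hlim1.add hlim2).add hlim3
  simp only [add_zero] at hlim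
  obtain ⟨N₀, hN₀⟩ := eventually_atTop.1 (hlim.eventually_lt_const he0)
  refine ⟨max N₀ 1, fun N hN => ?_⟩
  have hsum := hN₀ N (le_of_max_le_left hN)
  have hN1 : (0 : ℝ) < N := by exact_mod_cast (le_of_max_le_right hN)
  set M := ⌈Real.exp (N * R)⌉₊ with hMdef
  have hMpos : 0 < M := Nat.ceil_pos.2 (Real.exp_pos _)
  -- The typical set includes the cost condition, which involves the codeword alone. Any codeword
  -- with a nonempty slice of `T` then satisfies it.
  let T : Set (Fin N → S × O) := {a | N * g ≤ ∑ t, i (a t) ∧ |(∑ t, c (a t).1) / N - cbar| ≤ ε}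
  have hT : MeasurableSet T :=
    MeasurableSet.inter
      (measurableSet_le measurable_const (by fun_prop) :
        MeasurableSet {a : Fin N → S × O | N * g ≤ ∑ t, i (a t)})
      (measurableSet_le (by fun_prop) measurable_const :
        MeasurableSet {a : Fin N → S × O | |(∑ t, c (a t).1) / N - cbar| ≤ ε})
  let E : (Fin N → S) → Set (Fin N → O) := fun x => {o | (fun t => (x t, o t)) ∈ T}
  have hE : ∀ x, MeasurableSet (E x) := fun x =>
    hT.preimage (by fun_prop : Measurable fun (o : Fin N → O) t => (x t, o t))
  have hTreal : 1 - e + Real.exp (N * (R - g)) < (Measure.pi fun _ : Fin N => J).real T := by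
    have hc : (Measure.pi fun _ : Fin N => J).real Tᶜ ≤
        (Measure.pi fun _ : Fin N => J).real {a | I - g ≤ |(∑ t, i (a t)) / N - I|} +
        (Measure.pi fun _ : Fin N => J).real {a | ε ≤ |(∑ t, c (a t).1) / N - cbar|} := by
      refine (measureReal_mono ?_).trans (measureReal_union_le _ _)
      intro a ha
      by_contra hcon
      simp only [Set.mem_union, Set.mem_ofPred_eq, not_or, not_le] at hcon
      refine ha ⟨?_, hcon.2.le⟩
      have h1 := (abs_lt.1 hcon.1).1
      have h2 : g < (∑ t, i (a t)) / N := by linarith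
      rw [lt_div_iff₀ hN1] at h2
      linarith
    have := probReal_compl_eq_one_sub (μ := Measure.pi fun _ : Fin N => J) hT
    linarith
  -- Markov's inequality for the product of the `exp (i (x t, o t))`. The coordinates are
  -- independent under the output law and each factor has mean at most one by `hexp`, while the
  -- product is at least `exp (N * g)` on `E x`.
  have hθ : ∀ x, (∑ x' : Fin N → S, (∏ t, w (x' t)) • Measure.pi (fun t => W (x' t))) (E x) ≤
      ENNReal.ofReal (Real.exp (-(N * g))) := by
    intro x
    rw [← pi_sum_smul w hw W N]
    have hmf : ∀ t, Measurable fun o : O => ENNReal.ofReal (Real.exp (i (x t, o))) := fun t => by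
      fun_prop
    have hmark := mul_meas_ge_le_lintegral (μ := Measure.pi fun _ : Fin N => ∑ s, w s • W s)
      (f := fun o => ∏ t, ENNReal.ofReal (Real.exp (i (x t, o t)))) (by fun_prop)
      (ENNReal.ofReal (Real.exp (N * g)))
    have hprod : ∫⁻ o, ∏ t, ENNReal.ofReal (Real.exp (i (x t, o t)))
        ∂(Measure.pi fun _ : Fin N => ∑ s, w s • W s) ≤ 1 := by
      have hind : iIndepFun (fun t (o : Fin N → O) => ENNReal.ofReal (Real.exp (i (x t, o t))))
          (Measure.pi fun _ : Fin N => ∑ s, w s • W s) :=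
        iIndepFun_pi (X := fun t o => ENNReal.ofReal (Real.exp (i (x t, o))))
          fun t => (hmf t).aemeasurable
      rw [lintegral_prod_eq_prod_lintegral_of_indepFun Finset.univ _ hind (fun t => by fun_prop)]
      refine Finset.prod_le_one' fun t _ => ?_
      have := (measurePreserving_eval (fun _ : Fin N => ∑ s, w s • W s) t).lintegral_comp (hmf t)
      exact this.le.trans (hexp _)
    have hsub : E x ⊆ {o | ENNReal.ofReal (Real.exp (N * g)) ≤
        ∏ t, ENNReal.ofReal (Real.exp (i (x t, o t)))} := by
      intro o ho
      simp only [Set.mem_ofPred_eq]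
      rw [← ENNReal.ofReal_prod_of_nonneg fun t _ => (Real.exp_pos _).le, ← Real.exp_sum]
      exact ENNReal.ofReal_le_ofReal (Real.exp_le_exp.2 ho.1)
    have h1 := (mul_le_mul_right (measure_mono hsub) _).trans (hmark.trans hprod)
    rw [Real.exp_neg, ENNReal.ofReal_inv_of_pos (Real.exp_pos _)]
    exact ENNReal.le_inv_iff_mul_le.2 (by rwa [mul_comm])
  have hprodw : ∑ x : Fin N → S, ∏ t, w (x t) = 1 := by
    classical
    have := Finset.prod_univ_sum (fun _ : Fin N => (Finset.univ : Finset S)) fun _ s => w s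
    rw [Fintype.piFinset_univ] at this
    rw [← this]
    simp [hw]
  obtain ⟨x, D, hxD⟩ := exists_disjoint_decoding_sets (fun x : Fin N → S => ∏ t, w (x t)) hprodw
    (fun x => Measure.pi fun t => W (x t)) E hE (ENNReal.ofReal (Real.exp (-(N * g))))
    (ENNReal.ofReal (1 - e)) hθ M (by
      intro m hm
      rw [← pi_jointMeasure_apply hw hT, ← hJ,
        ← ENNReal.ofReal_toReal (measure_ne_top (Measure.pi fun _ : Fin N => J) T),
        ← ENNReal.ofReal_natCast, ← ENNReal.ofReal_mul (by positivity),
        ← ENNReal.ofReal_add (by positivity) (by linarith), ← measureReal_def,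
        ENNReal.ofReal_lt_ofReal_iff_of_nonneg (add_nonneg (by positivity) (by linarith))]
      -- `M` is a ceiling, so every `m < M` is still below `exp (N * R)` itself.
      have h1 : (m : ℝ) ≤ Real.exp (N * R) := (Nat.lt_ceil.1 hm).le
      have h2 : (m : ℝ) * Real.exp (-(N * g)) ≤ Real.exp (N * (R - g)) := by
        calc (m : ℝ) * Real.exp (-(N * g)) ≤ Real.exp (N * R) * Real.exp (-(N * g)) := by gcongr
          _ = _ := by rw [← Real.exp_add]; ring_nf
      linarith)
  obtain ⟨decode, hdm, hdec⟩ := exists_measurable_decoder hMpos (fun m : Fin M => D m)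
    (fun m => (hxD m m.2).1) fun m j hj => (hxD m m.2).2.2.2 j hj
  refine ⟨M, fun m => x m, decode, hdm, Nat.le_ceil _, fun m => ⟨?_, ?_⟩⟩
  · obtain ⟨hDm, -, hc, -⟩ := hxD m m.2
    have hsub : {o | decode o ≠ m} ⊆ (D m)ᶜ := fun o ho ho' => ho (hdec m o ho')
    refine (measure_mono hsub).trans ?_
    rw [prob_compl_eq_one_sub hDm]
    refine (tsub_le_tsub_left hc 1).trans ?_
    rw [← ENNReal.ofReal_one, ← ENNReal.ofReal_sub _ (by linarith)]
    exact ENNReal.ofReal_le_ofReal (by linarith)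
  · obtain ⟨-, hsub, hc, -⟩ := hxD m m.2
    -- A single point of the decoding region certifies that the codeword meets the cost constraint.
    have hpos : (Measure.pi fun t => W (x m t)) (D m) ≠ 0 :=
      ((ENNReal.ofReal_pos.2 (by linarith : 0 < 1 - e)).trans_le hc).ne'
    obtain ⟨o, ho⟩ := nonempty_of_measure_ne_zero hpos
    exact (hsub ho).2

end Coding

/-! ### Translated Gaussian noise and its density with respect to the centred noise. -/

section Shift

/-- The density of the standard Gaussian law translated by `b`, with respect to the centred one. -/
def shiftDensity {n : ℕ} (b y : Fin n → ℝ) : ℝ := Real.exp (∑ i, (b i * y i - b i ^ 2 / 2))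

theorem shiftDensity_pos {n : ℕ} (b y : Fin n → ℝ) : 0 < shiftDensity b y := Real.exp_pos _

theorem measurable_shiftDensity {n : ℕ} :
    Measurable fun p : (Fin n → ℝ) × (Fin n → ℝ) => shiftDensity p.1 p.2 := by
  unfold shiftDensity; fun_prop

/-- Completing the square. The bound does not depend on the shift, which is what the `bounded` field
of `IsCondDensity` asks for and what makes averages over the shift finite. -/
theorem shiftDensity_le {n : ℕ} (b y : Fin n → ℝ) :
    shiftDensity b y ≤ Real.exp (∑ i, y i ^ 2 / 2) :=
  Real.exp_le_exp.2 (Finset.sum_le_sum fun i _ => by nlinarith [sq_nonneg (y i - b i)])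

theorem gaussianReal_eq_withDensity (b : ℝ) : gaussianReal b 1 =
    (gaussianReal 0 1).withDensity fun y => ENNReal.ofReal (Real.exp (b * y - b ^ 2 / 2)) := by
  rw [gaussianReal_of_var_ne_zero _ one_ne_zero, gaussianReal_of_var_ne_zero _ one_ne_zero,
    ← withDensity_mul _ (measurable_gaussianPDF _ _) (by fun_prop)]
  congr 1
  funext y
  rw [Pi.mul_apply, gaussianPDF_def, gaussianPDF_def, ← ENNReal.ofReal_mul (gaussianPDFReal_nonneg _ _ _),
    gaussianPDFReal_def, gaussianPDFReal_def]
  simp only [NNReal.coe_one]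
  rw [mul_assoc _ (Real.exp _), ← Real.exp_add]
  congr 3
  ring

theorem pi_withDensity {n : ℕ} {A : Type*} [MeasurableSpace A] (μ : Measure A)
    [IsProbabilityMeasure μ] (f : Fin n → A → ℝ≥0∞) (hf : ∀ i, Measurable (f i))
    (hf1 : ∀ i, IsProbabilityMeasure (μ.withDensity (f i))) :
    Measure.pi (fun i => μ.withDensity (f i)) =
      (Measure.pi fun _ => μ).withDensity fun y => ∏ i, f i (y i) := by
  refine Measure.pi_eq fun T hT => ?_
  have hmT : ∀ i, Measurable ((T i).indicator (f i)) := fun i => (hf i).indicator (hT i)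
  rw [withDensity_apply _ (MeasurableSet.univ_pi hT), ← lintegral_indicator (MeasurableSet.univ_pi hT)]
  have h1 : (Set.univ.pi T).indicator (fun y => ∏ i, f i (y i)) =
      fun y => ∏ i, (T i).indicator (f i) (y i) := by
    funext y
    by_cases hy : y ∈ Set.univ.pi T
    · rw [Set.indicator_of_mem hy]
      exact Finset.prod_congr rfl fun i _ =>
        (Set.indicator_of_mem (hy i (Set.mem_univ i)) _).symm
    · rw [Set.indicator_of_notMem hy]
      obtain ⟨i, hi⟩ : ∃ i, y i ∉ T i := by simpa [Set.mem_pi] using hy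
      exact (Finset.prod_eq_zero (Finset.mem_univ i) (Set.indicator_of_notMem hi _)).symm
  have hind : iIndepFun (fun i (y : Fin n → A) => (T i).indicator (f i) (y i))
      (Measure.pi fun _ => μ) :=
    iIndepFun_pi (X := fun i => (T i).indicator (f i)) fun i => (hmT i).aemeasurable
  rw [h1, lintegral_prod_eq_prod_lintegral_of_indepFun Finset.univ _ hind
    (fun i => (hmT i).comp (measurable_pi_apply i))]
  refine Finset.prod_congr rfl fun i _ => ?_
  have := (measurePreserving_eval (fun _ : Fin n => μ) i).lintegral_comp (hmT i)
  simp only [Function.eval] at this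
  rw [this, withDensity_apply _ (hT i), lintegral_indicator (hT i)]

/-- The finite-dimensional Cameron–Martin formula: each coordinate is a shifted Gaussian, and the
one-dimensional densities multiply. -/
theorem map_add_noiseLaw {n : ℕ} (b : Fin n → ℝ) :
    (noiseLaw n).map (fun w => b + w) =
      (noiseLaw n).withDensity fun y => ENNReal.ofReal (shiftDensity b y) := by
  have h1 : (noiseLaw n).map (fun w => b + w) = Measure.pi fun i => gaussianReal (b i) 1 := by
    have h2 : ∀ i, (gaussianReal 0 1).map (fun x => b i + x) = gaussianReal (b i) 1 := fun i => by
      rw [gaussianReal_map_const_add, zero_add]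
    have : ∀ i, SigmaFinite ((gaussianReal 0 1).map (fun x => b i + x)) := fun i => by
      rw [h2]; infer_instance
    have h3 := Measure.pi_map_pi (μ := fun _ : Fin n => gaussianReal 0 1)
      (f := fun i x => b i + x) (fun i => by fun_prop)
    simp_rw [h2] at h3
    exact h3
  simp_rw [h1, gaussianReal_eq_withDensity (b _)]
  rw [pi_withDensity (gaussianReal 0 1) _ (fun i => by fun_prop)
    (fun i => by rw [← gaussianReal_eq_withDensity]; infer_instance)]
  unfold shiftDensity noiseLaw
  congr 1
  funext y
  rw [Real.exp_sum, ENNReal.ofReal_prod_of_nonneg fun i _ => (Real.exp_pos _).le]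

theorem lintegral_add_noiseLaw {n : ℕ} (b : Fin n → ℝ) {f : (Fin n → ℝ) → ℝ≥0∞}
    (hf : Measurable f) : ∫⁻ w, f (b + w) ∂(noiseLaw n) =
      ∫⁻ y, ENNReal.ofReal (shiftDensity b y) * f y ∂(noiseLaw n) := by
  have hm : Measurable fun y => ENNReal.ofReal (shiftDensity b y) :=
    (measurable_shiftDensity.comp (by fun_prop : Measurable fun y => (b, y))).ennreal_ofReal
  rw [← lintegral_map hf (measurable_const_add b), map_add_noiseLaw,
    lintegral_withDensity_eq_lintegral_mul _ hm hf]
  rfl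

variable {n : ℕ} {Ω α γ : Type*} [MeasurableSpace Ω] [MeasurableSpace α] [MeasurableSpace γ]

theorem isCondDensity_shiftDensity {b : γ → α → Fin n → ℝ}
    (hb : Measurable fun p : γ × α => b p.1 p.2) :
    IsCondDensity (noiseLaw n) fun z x y => shiftDensity (b z x) y where
  measurable := measurable_shiftDensity.comp
    ((hb.comp (by fun_prop : Measurable fun p : γ × α × (Fin n → ℝ) => (p.1, p.2.1))).prodMk
      (by fun_prop : Measurable fun p : γ × α × (Fin n → ℝ) => p.2.2))
  pos _ _ _ := shiftDensity_pos _ _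
  bounded y := ⟨_, fun z x => shiftDensity_le (b z x) y⟩
  lintegral_eq_one z x := by
    have := lintegral_add_noiseLaw (b z x) (f := fun _ => 1) measurable_const
    simpa using this.symm

/-- After Fubini, `z` and `x` are fixed, and replacing the noise `w` by `y = b z x + w` costs
exactly the factor `shiftDensity`. -/
theorem hasCondDensity_shiftDensity {μ : Measure Ω} {V : Ω → α} {Z : Ω → γ} {W Y : Ω → Fin n → ℝ}
    (hV : Measurable V) (hZ : Measurable Z) (hW : Measurable W) {P : Measure γ} {ρ : Measure α}
    [SFinite P] [SFinite ρ]
    (hlaw : μ.map (fun ω => (Z ω, V ω, W ω)) = P.prod (ρ.prod (noiseLaw n)))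
    {b : γ → α → Fin n → ℝ} (hb : Measurable fun p : γ × α => b p.1 p.2)
    (hY : ∀ ω, Y ω = b (Z ω) (V ω) + W ω) :
    HasCondDensity μ V Y Z P ρ (noiseLaw n) fun z x y => shiftDensity (b z x) y := by
  have hk := isCondDensity_shiftDensity hb
  have hYm : Measurable Y := by
    rw [show Y = fun ω => b (Z ω) (V ω) + W ω from funext hY]
    exact (hb.comp (hZ.prodMk hV)).add hW
  refine ⟨hV, hYm, hZ, Measure.ext_of_lintegral _ fun f hf => ?_⟩
  have hb3 : Measurable fun p : γ × α × (Fin n → ℝ) => b p.1 p.2.1 :=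
    hb.comp (by fun_prop : Measurable fun p : γ × α × (Fin n → ℝ) => (p.1, p.2.1))
  have hg : Measurable fun p : γ × α × (Fin n → ℝ) => f (p.1, p.2.1, b p.1 p.2.1 + p.2.2) := by
    fun_prop
  have hd := hk.measurable.ennreal_ofReal
  rw [lintegral_map hf (hZ.prodMk (hV.prodMk hYm)),
    lintegral_withDensity_eq_lintegral_mul _ hd hf]
  simp_rw [hY]
  rw [← lintegral_map (f := fun p : γ × α × (Fin n → ℝ) => f (p.1, p.2.1, b p.1 p.2.1 + p.2.2)) hg
    (hZ.prodMk (hV.prodMk hW)), hlaw, lintegral_prod _ hg.aemeasurable,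
    lintegral_prod _ (hd.mul hf).aemeasurable]
  refine lintegral_congr fun z => ?_
  have hz : Measurable fun q : α × (Fin n → ℝ) => (z, q) := by fun_prop
  have e1 := lintegral_prod (μ := ρ) (ν := noiseLaw n) _ (hg.comp hz).aemeasurable
  have e2 := lintegral_prod (μ := ρ) (ν := noiseLaw n) _ ((hd.mul hf).comp hz).aemeasurable
  simp only [Function.comp_apply] at e1 e2
  rw [e1, e2]
  refine lintegral_congr fun x => ?_
  exact lintegral_add_noiseLaw (b z x)
    (hf.comp (by fun_prop : Measurable fun y : Fin n → ℝ => (z, x, y)))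

theorem log_shiftDensity_add (b w : Fin n → ℝ) :
    Real.log (shiftDensity b (b + w)) = ∑ i, (b i * w i + b i ^ 2 / 2) := by
  rw [shiftDensity, Real.log_exp]
  refine Finset.sum_congr rfl fun i _ => ?_
  rw [Pi.add_apply]
  ring

theorem integrable_log_shiftDensity {μ : Measure Ω} {B W : Ω → Fin n → ℝ}
    (hB : ∀ i, MemLp (fun ω => B ω i) 2 μ) (hW : ∀ i, MemLp (fun ω => W ω i) 2 μ) :
    Integrable (fun ω => Real.log (shiftDensity (B ω) (B ω + W ω))) μ := by
  simp_rw [log_shiftDensity_add]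
  exact integrable_finsetSum _ fun i _ =>
    ((hB i).integrable_mul (hW i)).add ((hB i).integrable_sq.div_const 2)

theorem integral_log_shiftDensity_le {μ : Measure Ω} {B W : Ω → Fin n → ℝ}
    (hB : ∀ i, MemLp (fun ω => B ω i) 2 μ) (hW : ∀ i, MemLp (fun ω => W ω i) 2 μ) :
    ∫ ω, Real.log (shiftDensity (B ω) (B ω + W ω)) ∂μ ≤
      ∑ i, (∫ ω, B ω i ^ 2 ∂μ + (∫ ω, W ω i ^ 2 ∂μ) / 2) := by
  have hint : ∀ i, Integrable (fun ω => B ω i ^ 2 + W ω i ^ 2 / 2) μ := fun i =>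
    (hB i).integrable_sq.add ((hW i).integrable_sq.div_const 2)
  calc ∫ ω, Real.log (shiftDensity (B ω) (B ω + W ω)) ∂μ
      ≤ ∫ ω, ∑ i, (B ω i ^ 2 + W ω i ^ 2 / 2) ∂μ := by
        refine integral_mono (integrable_log_shiftDensity hB hW)
          (integrable_finsetSum _ fun i _ => hint i) fun ω => ?_
        simp only [log_shiftDensity_add]
        -- Here `b w ≤ (b² + w²) / 2`. This is cruder than using a vanishing cross term, but needs
        -- no independence of `B` and `W`.
        exact Finset.sum_le_sum fun i _ => by nlinarith [sq_nonneg (B ω i - W ω i)]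
    _ = _ := by
        rw [integral_finsetSum _ fun i _ => hint i]
        refine Finset.sum_congr rfl fun i _ => ?_
        rw [integral_add (hB i).integrable_sq ((hW i).integrable_sq.div_const 2), integral_div]

end Shift

theorem integral_comp_measurePreserving {A B : Type*} [MeasurableSpace A] [MeasurableSpace B]
    {μ : Measure A} {ν : Measure B} {g : A → B} (hg : MeasurePreserving g μ ν) {f : B → ℝ}
    (hf : AEStronglyMeasurable f ν) : ∫ a, f (g a) ∂μ = ∫ b, f b ∂ν := by
  have h := hg.map_eq
  subst h
  exact (integral_map hg.measurable.aemeasurable hf).symm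

/-! ### Second moments of the noiseless output `A H X`. -/

section Moments

/-- The vector `A H x`. -/
def gain {n : ℕ} (z : (Fin n → Bool) × (Fin n → Fin n → ℝ)) (x : Fin n → ℝ) : Fin n → ℝ :=
  fun i => bit (z.1 i) * ∑ j, z.2 i j * x j

theorem received_eq {n : ℕ} (a : Fin n → Bool) (h : Fin n → Fin n → ℝ) (x w : Fin n → ℝ) :
    received a h x w = gain (a, h) x + w := by
  unfold received gain
  congr 1
  funext i
  simp only [Matrix.mulVec, dotProduct, Matrix.diagonal_mul, Matrix.of_apply, Finset.mul_sum,
    mul_assoc]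

theorem measurable_bit : Measurable bit := measurable_of_finite _

theorem bit_sq_le_one (b : Bool) : bit b ^ 2 ≤ 1 := by cases b <;> simp [bit]

theorem abs_bit_le_one (b : Bool) : |bit b| ≤ 1 := by cases b <;> simp [bit]

theorem measurable_gain {n : ℕ} : Measurable fun p :
    ((Fin n → Bool) × (Fin n → Fin n → ℝ)) × (Fin n → ℝ) => gain p.1 p.2 := by
  have := measurable_bit
  unfold gain
  fun_prop

theorem measurable_sparseSignal {n : ℕ} : Measurable fun p : (Fin n → Bool) × (Fin n → ℝ) =>
    sparseSignal p.1 p.2 := by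
  have := measurable_bit
  unfold sparseSignal
  fun_prop

variable (M : Model) {n : ℕ}

/-- The law of `(A, H)`. -/
abbrev Model.samplingMatrixLaw (n : ℕ) : Measure ((Fin n → Bool) × (Fin n → Fin n → ℝ)) :=
  (M.sampling.law n).prod (M.matrixLaw n)

theorem measurePreserving_row (i : Fin n) :
    MeasurePreserving (fun z : (Fin n → Bool) × (Fin n → Fin n → ℝ) => z.2 i)
      (M.samplingMatrixLaw n) (Measure.pi fun _ => (M.entryLaw n : Measure ℝ)) :=
  (measurePreserving_eval (fun _ : Fin n => Measure.pi fun _ : Fin n => (M.entryLaw n : Measure ℝ))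
    i).comp measurePreserving_snd

theorem measurePreserving_entry (i j : Fin n) :
    MeasurePreserving (fun z : (Fin n → Bool) × (Fin n → Fin n → ℝ) => z.2 i j)
      (M.samplingMatrixLaw n) (M.entryLaw n : Measure ℝ) :=
  (measurePreserving_eval (fun _ : Fin n => (M.entryLaw n : Measure ℝ)) j).comp
    (measurePreserving_row M i)

theorem memLp_entry (hL2 : MemLp id 2 (M.entryLaw n : Measure ℝ)) (i j : Fin n) :
    MemLp (fun z : (Fin n → Bool) × (Fin n → Fin n → ℝ) => z.2 i j) 2 (M.samplingMatrixLaw n) :=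
  hL2.comp_measurePreserving (measurePreserving_entry M i j)

/-- Distinct entries of a row are independent and centred, hence uncorrelated. -/
theorem integral_entry_mul
    (hmean : ∫ x, x ∂(M.entryLaw n : Measure ℝ) = 0)
    (hvar : Var[id; (M.entryLaw n : Measure ℝ)] = 1 / n) (i j k : Fin n) :
    ∫ z, z.2 i j * z.2 i k ∂(M.samplingMatrixLaw n) = if j = k then 1 / (n : ℝ) else 0 := by
  split_ifs with hjk
  · subst hjk
    have h1 := integral_comp_measurePreserving (measurePreserving_entry M i j)
      (f := fun x => x ^ 2) (by fun_prop)
    rw [variance_of_integral_eq_zero aemeasurable_id hmean] at hvar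
    simp_rw [← sq]
    rw [h1, ← hvar]
    rfl
  · have h1 := integral_comp_measurePreserving (measurePreserving_row M i)
      (f := fun r : Fin n → ℝ => r j * r k) (by fun_prop)
    have hI : iIndepFun (fun (j : Fin n) (r : Fin n → ℝ) => r j)
        (Measure.pi fun _ => (M.entryLaw n : Measure ℝ)) :=
      iIndepFun_pi (X := fun _ x => x) fun _ => aemeasurable_id
    have h2 := integral_comp_measurePreserving
      (measurePreserving_eval (fun _ : Fin n => (M.entryLaw n : Measure ℝ)) j)
      (f := fun x => x) (by fun_prop)
    simp only [Function.eval] at h2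
    rw [h1, (hI.indepFun hjk).integral_fun_mul_eq_mul_integral
      (measurable_pi_apply j).aestronglyMeasurable (measurable_pi_apply k).aestronglyMeasurable,
      h2, hmean, zero_mul]

/-- The law of `(S, U, W)`. -/
abbrev Model.sourceNoiseLaw (n : ℕ) : Measure ((Fin n → Bool) × (Fin n → ℝ) × (Fin n → ℝ)) :=
  (patternLaw M.f n).prod ((M.gaussianLaw n).prod (noiseLaw n))

theorem measurePreserving_gaussian (j : Fin n) :
    MeasurePreserving (fun r : (Fin n → Bool) × (Fin n → ℝ) × (Fin n → ℝ) => r.2.1 j)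
      (M.sourceNoiseLaw n) (gaussianReal 0 M.variance) :=
  (measurePreserving_eval (fun _ : Fin n => gaussianReal 0 M.variance) j).comp
    (measurePreserving_fst.comp measurePreserving_snd)

theorem measurePreserving_noise (j : Fin n) :
    MeasurePreserving (fun r : (Fin n → Bool) × (Fin n → ℝ) × (Fin n → ℝ) => r.2.2 j)
      (M.sourceNoiseLaw n) (gaussianReal 0 1) :=
  (measurePreserving_eval (fun _ : Fin n => gaussianReal 0 1) j).comp
    (measurePreserving_snd.comp measurePreserving_snd)

theorem integral_sq_gaussianReal (v : ℝ≥0) : ∫ x, x ^ 2 ∂(gaussianReal 0 v) = v := by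
  have h := variance_of_integral_eq_zero (X := id) (μ := gaussianReal 0 v) aemeasurable_id
    integral_id_gaussianReal
  rw [variance_id_gaussianReal] at h
  exact h.symm

theorem memLp_sparseSignal (j : Fin n) :
    MemLp (fun r : (Fin n → Bool) × (Fin n → ℝ) × (Fin n → ℝ) => sparseSignal r.1 r.2.1 j) 2
      (M.sourceNoiseLaw n) := by
  have hb := measurable_bit
  refine ((memLp_id_gaussianReal' (μ := 0) (v := M.variance) 2 (by simp)).comp_measurePreserving
    (measurePreserving_gaussian M j)).of_le ?_ (ae_of_all _ fun r => ?_)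
  · unfold sparseSignal; fun_prop
  · simp only [sparseSignal, norm_mul, Real.norm_eq_abs, Function.comp_apply, id]
    exact mul_le_of_le_one_left (abs_nonneg _) (abs_bit_le_one _)

theorem integral_sparseSignal_sq_le (j : Fin n) :
    ∫ r, sparseSignal r.1 r.2.1 j ^ 2 ∂(M.sourceNoiseLaw n) ≤ M.variance := by
  have h1 := integral_comp_measurePreserving (measurePreserving_gaussian M j)
    (f := fun x => x ^ 2) (by fun_prop)
  rw [integral_sq_gaussianReal] at h1
  rw [← h1]
  have hi := ((memLp_id_gaussianReal' (μ := 0) (v := M.variance) 2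
    (by simp)).comp_measurePreserving (measurePreserving_gaussian M j)).integrable_sq
  refine integral_mono (memLp_sparseSignal M j).integrable_sq hi fun r => ?_
  simp only [sparseSignal, mul_pow]
  exact mul_le_of_le_one_left (sq_nonneg _) (bit_sq_le_one _)

theorem memLp_noise (i : Fin n) : MemLp (fun ω : Sample n => ω.W i) 2 (M.law n) :=
  ((memLp_id_gaussianReal' (μ := 0) (v := 1) 2 (by simp)).comp_measurePreserving
    (measurePreserving_noise M i)).comp_measurePreserving measurePreserving_snd

theorem integral_noise_sq (i : Fin n) : ∫ ω : Sample n, ω.W i ^ 2 ∂(M.law n) = 1 := by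
  have h1 := integral_comp_measurePreserving
    ((measurePreserving_noise M i).comp
      (measurePreserving_snd (μ := M.samplingMatrixLaw n))) (f := fun x => x ^ 2) (by fun_prop)
  rw [integral_sq_gaussianReal] at h1
  exact h1

/-- In the expanded square of a row of `H` times `X`, independence of `H` and `X` factors each mean
and the off-diagonal terms vanish. The diagonal leaves `(1 / n) ∑ E X_j ^ 2 ≤ σ²`, and
multiplication by an entry of `A` can only decrease the square. -/
theorem memLp_gain_and_integral_sq_le (hL2 : MemLp id 2 (M.entryLaw n : Measure ℝ))
    (hmean : ∫ x, x ∂(M.entryLaw n : Measure ℝ) = 0)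
    (hvar : Var[id; (M.entryLaw n : Measure ℝ)] = 1 / n) (i : Fin n) :
    MemLp (fun ω : Sample n => gain ω.AH ω.X i) 2 (M.law n) ∧
      ∫ ω : Sample n, gain ω.AH ω.X i ^ 2 ∂(M.law n) ≤ M.variance := by
  let q : Sample n → ℝ := fun ω => ∑ j, ω.1.2 i j * sparseSignal ω.2.1 ω.2.2.1 j
  have hqm : Measurable q := by
    have hs : Measurable fun ω : Sample n => sparseSignal ω.2.1 ω.2.2.1 :=
      measurable_sparseSignal.comp (by fun_prop : Measurable fun ω : Sample n => (ω.2.1, ω.2.2.1))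
    fun_prop
  have hqsq : ∀ ω, q ω ^ 2 = ∑ j, ∑ k, (ω.1.2 i j * ω.1.2 i k) *
      (sparseSignal ω.2.1 ω.2.2.1 j * sparseSignal ω.2.1 ω.2.2.1 k) := by
    intro ω
    simp only [q, sq, Finset.sum_mul_sum]
    exact Finset.sum_congr rfl fun j _ => Finset.sum_congr rfl fun k _ => by ring
  have hint : ∀ j k, Integrable (fun ω : Sample n => (ω.1.2 i j * ω.1.2 i k) *
      (sparseSignal ω.2.1 ω.2.2.1 j * sparseSignal ω.2.1 ω.2.2.1 k)) (M.law n) := fun j k =>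
    Integrable.mul_prod (μ := M.samplingMatrixLaw n) (ν := M.sourceNoiseLaw n)
      (f := fun z => z.2 i j * z.2 i k)
      (g := fun r => sparseSignal r.1 r.2.1 j * sparseSignal r.1 r.2.1 k)
      ((memLp_entry M hL2 i j).integrable_mul (memLp_entry M hL2 i k))
      ((memLp_sparseSignal M j).integrable_mul (memLp_sparseSignal M k))
  have hqi : Integrable (fun ω => q ω ^ 2) (M.law n) := by
    simp_rw [hqsq]
    exact integrable_finsetSum _ fun j _ => integrable_finsetSum _ fun k _ => hint j k
  have hq2 : MemLp q 2 (M.law n) := (memLp_two_iff_integrable_sq hqm.aestronglyMeasurable).2 hqi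
  have hgain : ∀ ω : Sample n, gain ω.AH ω.X i = bit (ω.1.1 i) * q ω := fun ω => rfl
  have hm : Measurable fun ω : Sample n => gain ω.AH ω.X i := by
    have := measurable_bit
    simp_rw [hgain]
    fun_prop
  have hL : MemLp (fun ω : Sample n => gain ω.AH ω.X i) 2 (M.law n) := by
    refine hq2.of_le hm.aestronglyMeasurable (ae_of_all _ fun ω => ?_)
    rw [hgain, norm_mul, Real.norm_eq_abs]
    exact mul_le_of_le_one_left (norm_nonneg _) (abs_bit_le_one _)
  refine ⟨hL, ?_⟩
  have hle : ∫ ω : Sample n, gain ω.AH ω.X i ^ 2 ∂(M.law n) ≤ ∫ ω, q ω ^ 2 ∂(M.law n) := by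
    refine integral_mono hL.integrable_sq hqi fun ω => ?_
    simp only [hgain, mul_pow]
    exact mul_le_of_le_one_left (sq_nonneg _) (bit_sq_le_one _)
  refine hle.trans ?_
  have heval : ∀ j k, ∫ ω : Sample n, (ω.1.2 i j * ω.1.2 i k) *
      (sparseSignal ω.2.1 ω.2.2.1 j * sparseSignal ω.2.1 ω.2.2.1 k) ∂(M.law n) =
      (if j = k then 1 / (n : ℝ) else 0) *
        ∫ r, sparseSignal r.1 r.2.1 j * sparseSignal r.1 r.2.1 k ∂(M.sourceNoiseLaw n) := by
    intro j k
    rw [← integral_entry_mul M hmean hvar i j k]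
    exact integral_prod_mul (μ := M.samplingMatrixLaw n) (ν := M.sourceNoiseLaw n)
      (fun z => z.2 i j * z.2 i k) (fun r => sparseSignal r.1 r.2.1 j * sparseSignal r.1 r.2.1 k)
  simp_rw [hqsq]
  rw [integral_finsetSum _ fun j _ => integrable_finsetSum _ fun k _ => hint j k]
  simp_rw [integral_finsetSum Finset.univ fun k _ => hint _ k, heval, ite_mul, zero_mul,
    Finset.sum_ite_eq, Finset.mem_univ, if_true, ← sq]
  have hn : (n : ℝ) ≠ 0 := by
    have : 0 < n := i.pos
    positivity
  calc ∑ j : Fin n, 1 / (n : ℝ) * ∫ r, sparseSignal r.1 r.2.1 j ^ 2 ∂(M.sourceNoiseLaw n)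
      ≤ ∑ j : Fin n, 1 / (n : ℝ) * M.variance :=
        Finset.sum_le_sum fun j _ => by
          have := integral_sparseSignal_sq_le M j
          gcongr
    _ = M.variance := by
        rw [Finset.sum_const, Finset.card_univ, Fintype.card_fin, nsmul_eq_mul]
        field_simp

end Moments

/-! ### The three mutual informations in terms of common mean log-densities. -/

section Informations

variable (M : Model) (n : ℕ)

/-- The law of `X`. -/
def Model.signalLaw : Measure (Fin n → ℝ) :=
  ((patternLaw M.f n).prod (M.gaussianLaw n)).map fun p => sparseSignal p.1 p.2

instance : IsProbabilityMeasure (M.signalLaw n) :=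
  Measure.isProbabilityMeasure_map measurable_sparseSignal.aemeasurable

/-- The density of `Y` given `(A, H)` and `X`. -/
def densityX (z : (Fin n → Bool) × (Fin n → Fin n → ℝ)) (x y : Fin n → ℝ) : ℝ :=
  shiftDensity (gain z x) y

/-- The density of `Y` given `(A, H, S)` and `U`. -/
def densityU (z : ((Fin n → Bool) × (Fin n → Fin n → ℝ)) × (Fin n → Bool)) (u y : Fin n → ℝ) : ℝ :=
  shiftDensity (gain z.1 (sparseSignal z.2 u)) y

/-- The density of `Y` given `(A, H)` and `S`. -/
def Model.densityS (z : (Fin n → Bool) × (Fin n → Fin n → ℝ)) (s : Fin n → Bool)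
    (y : Fin n → ℝ) : ℝ :=
  marginalDensity (M.gaussianLaw n) (densityU n) (z, s) y

variable {n}

theorem measurable_AH : Measurable (Sample.AH : Sample n → _) := by unfold Sample.AH; fun_prop

theorem measurable_S : Measurable (Sample.S : Sample n → _) := by unfold Sample.S; fun_prop

theorem measurable_U : Measurable (Sample.U : Sample n → _) := by unfold Sample.U; fun_prop

theorem measurable_W : Measurable (Sample.W : Sample n → _) := by unfold Sample.W; fun_prop

theorem measurable_X : Measurable (Sample.X : Sample n → _) :=
  measurable_sparseSignal.comp (measurable_S.prodMk measurable_U)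

theorem Y_eq (ω : Sample n) : ω.Y = gain ω.AH ω.X + ω.W := received_eq _ _ _ _

theorem isCondDensity_densityX : IsCondDensity (noiseLaw n) (densityX n) :=
  isCondDensity_shiftDensity measurable_gain

theorem measurable_gain_sparseSignal : Measurable fun
    p : (((Fin n → Bool) × (Fin n → Fin n → ℝ)) × (Fin n → Bool)) × (Fin n → ℝ) =>
      gain p.1.1 (sparseSignal p.1.2 p.2) := by
  have h : Measurable fun
      p : (((Fin n → Bool) × (Fin n → Fin n → ℝ)) × (Fin n → Bool)) × (Fin n → ℝ) =>
        sparseSignal p.1.2 p.2 :=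
    measurable_sparseSignal.comp (by fun_prop : Measurable fun
      p : (((Fin n → Bool) × (Fin n → Fin n → ℝ)) × (Fin n → Bool)) × (Fin n → ℝ) => (p.1.2, p.2))
  exact measurable_gain.comp ((by fun_prop : Measurable fun
    p : (((Fin n → Bool) × (Fin n → Fin n → ℝ)) × (Fin n → Bool)) × (Fin n → ℝ) => p.1.1).prodMk h)

theorem isCondDensity_densityU : IsCondDensity (noiseLaw n) (densityU n) :=
  isCondDensity_shiftDensity measurable_gain_sparseSignal

theorem measurable_densityS : Measurable fun
    p : ((Fin n → Bool) × (Fin n → Fin n → ℝ)) × (Fin n → Bool) × (Fin n → ℝ) =>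
      M.densityS n p.1 p.2.1 p.2.2 := by
  have h := isCondDensity_densityU.measurable_marginalDensity (M.gaussianLaw n)
  have hp : Measurable fun
      p : ((Fin n → Bool) × (Fin n → Fin n → ℝ)) × (Fin n → Bool) × (Fin n → ℝ) =>
        ((p.1, p.2.1), p.2.2) := by fun_prop
  have hc := h.comp hp
  exact hc

/-- Averaging over `U` preserves positivity, total mass and the bound uniform in the parameters, so
the general results apply again with `S` as the input. -/
theorem isCondDensity_densityS : IsCondDensity (noiseLaw n) (M.densityS n) := by
  have hU := isCondDensity_densityU (n := n)
  refine ⟨measurable_densityS M, fun z s y => hU.marginalDensity_pos (M.gaussianLaw n) (z, s) y,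
    fun y => ?_, fun z s => hU.lintegral_marginalDensity (M.gaussianLaw n) (z, s)⟩
  obtain ⟨C, hC⟩ := hU.marginalDensity_bounded (M.gaussianLaw n) y
  exact ⟨C, fun z s => hC (z, s)⟩

theorem lintegral_law {F : ((Fin n → Bool) × (Fin n → Fin n → ℝ)) → (Fin n → Bool) →
    (Fin n → ℝ) → (Fin n → ℝ) → ℝ≥0∞}
    (hF : Measurable fun ω : Sample n => F ω.1 ω.2.1 ω.2.2.1 ω.2.2.2) :
    ∫⁻ ω : Sample n, F ω.AH ω.S ω.U ω.W ∂(M.law n) =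
      ∫⁻ z, ∫⁻ s, ∫⁻ u, ∫⁻ w, F z s u w ∂(noiseLaw n) ∂(M.gaussianLaw n) ∂(patternLaw M.f n)
        ∂(M.samplingMatrixLaw n) := by
  refine (lintegral_prod _ hF.aemeasurable).trans ?_
  refine lintegral_congr fun z => ?_
  have hz := hF.comp (measurable_prodMk_left (x := z))
  refine (lintegral_prod _ hz.aemeasurable).trans ?_
  refine lintegral_congr fun s => ?_
  exact lintegral_prod _ (hz.comp (measurable_prodMk_left (x := s))).aemeasurable

theorem map_AH_X_W : (M.law n).map (fun ω => (ω.AH, ω.X, ω.W)) =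
    (M.samplingMatrixLaw n).prod ((M.signalLaw n).prod (noiseLaw n)) := by
  refine Measure.ext_of_lintegral _ fun f hf => ?_
  have hs := measurable_sparseSignal (n := n)
  rw [lintegral_map hf (measurable_AH.prodMk (measurable_X.prodMk measurable_W))]
  have hF : Measurable fun ω : Sample n => f (ω.1, sparseSignal ω.2.1 ω.2.2.1, ω.2.2.2) :=
    hf.comp ((by fun_prop : Measurable fun ω : Sample n => ω.1).prodMk
      ((hs.comp (by fun_prop : Measurable fun ω : Sample n => (ω.2.1, ω.2.2.1))).prodMk
        (by fun_prop : Measurable fun ω : Sample n => ω.2.2.2)))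
  refine (lintegral_law M (F := fun z s u w => f (z, sparseSignal s u, w)) hF).trans ?_
  rw [lintegral_prod _ hf.aemeasurable]
  refine lintegral_congr fun z => ?_
  have hfz : Measurable fun q : (Fin n → ℝ) × (Fin n → ℝ) => f (z, q) := by fun_prop
  have hg : Measurable fun x => ∫⁻ w, f (z, x, w) ∂(noiseLaw n) := hfz.lintegral_prod_right'
  rw [lintegral_prod _ hfz.aemeasurable, Model.signalLaw, lintegral_map hg hs]
  exact (lintegral_prod _ (hg.comp hs).aemeasurable).symm

theorem map_AHS_U_W : (M.law n).map (fun ω => ((ω.AH, ω.S), ω.U, ω.W)) =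
    ((M.samplingMatrixLaw n).prod (patternLaw M.f n)).prod
      ((M.gaussianLaw n).prod (noiseLaw n)) := by
  refine Measure.ext_of_lintegral _ fun f hf => ?_
  rw [lintegral_map hf ((measurable_AH.prodMk measurable_S).prodMk
    (measurable_U.prodMk measurable_W))]
  refine (lintegral_law M (F := fun z s u w => f ((z, s), u, w)) (by fun_prop)).trans ?_
  have hg : Measurable fun p : ((Fin n → Bool) × (Fin n → Fin n → ℝ)) × (Fin n → Bool) =>
      ∫⁻ q, f (p, q) ∂((M.gaussianLaw n).prod (noiseLaw n)) := hf.lintegral_prod_right'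
  rw [lintegral_prod _ hf.aemeasurable, lintegral_prod _ hg.aemeasurable]
  refine lintegral_congr fun z => lintegral_congr fun s => ?_
  exact (lintegral_prod _ (hf.comp (measurable_prodMk_left (x := (z, s)))).aemeasurable).symm

theorem hasCondDensity_X : HasCondDensity (M.law n) Sample.X Sample.Y Sample.AH
    (M.samplingMatrixLaw n) (M.signalLaw n) (noiseLaw n) (densityX n) :=
  hasCondDensity_shiftDensity measurable_X measurable_AH measurable_W (map_AH_X_W M)
    measurable_gain Y_eq

theorem hasCondDensity_U : HasCondDensity (M.law n) Sample.U Sample.Y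
    (fun ω => (ω.AH, ω.S)) ((M.samplingMatrixLaw n).prod (patternLaw M.f n)) (M.gaussianLaw n)
    (noiseLaw n) (densityU n) :=
  hasCondDensity_shiftDensity measurable_U (measurable_AH.prodMk measurable_S) measurable_W
    (map_AHS_U_W M) measurable_gain_sparseSignal Y_eq

theorem measurable_Y : Measurable (Sample.Y : Sample n → _) := by
  simp_rw [show (Sample.Y : Sample n → _) = fun ω => gain ω.AH ω.X + ω.W from funext Y_eq]
  exact (measurable_gain.comp (measurable_AH.prodMk measurable_X)).add measurable_W

/-- This is the marginal law of `((A, H), S)` and `Y` in the `U`-model, with `S` moved from the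
conditioning variables to the input. -/
theorem hasCondDensity_S : HasCondDensity (M.law n) Sample.S Sample.Y Sample.AH
    (M.samplingMatrixLaw n) (patternLaw M.f n) (noiseLaw n) (M.densityS n) := by
  refine ⟨measurable_S, measurable_Y, measurable_AH, Measure.ext_of_lintegral _ fun f hf => ?_⟩
  have hm := (isCondDensity_densityS M (n := n)).measurable.ennreal_ofReal
  rw [lintegral_map hf (measurable_AH.prodMk (measurable_S.prodMk measurable_Y)),
    lintegral_withDensity_eq_lintegral_mul _ hm hf, lintegral_prod _ (hm.mul hf).aemeasurable]
  have h1 := (hasCondDensity_U M).lintegral_ZY isCondDensity_densityU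
    (F := fun p => f (p.1.1, p.1.2, p.2)) (by fun_prop)
  have hg : Measurable fun q : (((Fin n → Bool) × (Fin n → Fin n → ℝ)) × (Fin n → Bool)) ×
      (Fin n → ℝ) => ENNReal.ofReal (marginalDensity (M.gaussianLaw n) (densityU n) q.1 q.2) *
        f (q.1.1, q.1.2, q.2) :=
    (isCondDensity_densityU.measurable_marginalDensity _).ennreal_ofReal.mul (by fun_prop)
  refine h1.trans ?_
  rw [lintegral_prod _ hg.lintegral_prod_right'.aemeasurable]
  refine lintegral_congr fun z => ?_
  exact (lintegral_prod _
    ((hm.mul hf).comp (measurable_prodMk_left (x := z))).aemeasurable).symm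

/-- The law of `X` is the image of the law of `(S, U)`, so averaging over `X` splits into averages
over `U` and then `S`. This gives `infoX` and `infoS` the same subtracted term. -/
theorem marginalDensity_densityX (z : (Fin n → Bool) × (Fin n → Fin n → ℝ)) (y : Fin n → ℝ) :
    marginalDensity (M.signalLaw n) (densityX n) z y =
      marginalDensity (patternLaw M.f n) (M.densityS n) z y := by
  have hX := isCondDensity_densityX (n := n)
  have hS := isCondDensity_densityS M (n := n)
  refine (ENNReal.ofReal_eq_ofReal_iff (hX.marginalDensity_pos _ _ _).le
    (hS.marginalDensity_pos _ _ _).le).1 ?_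
  have hm := (hX.measurable_left z y).ennreal_ofReal
  rw [hX.ofReal_marginalDensity, hS.ofReal_marginalDensity, Model.signalLaw,
    lintegral_map hm measurable_sparseSignal]
  refine (lintegral_prod _ (hm.comp measurable_sparseSignal).aemeasurable).trans ?_
  refine lintegral_congr fun s => ?_
  exact (isCondDensity_densityU.ofReal_marginalDensity (M.gaussianLaw n) (z, s) y).symm

/-- The mean log-density `E log p(Y | A, H, X)`. -/
def Model.meanLogX (n : ℕ) : ℝ := ∫ ω : Sample n, Real.log (densityX n ω.AH ω.X ω.Y) ∂(M.law n)

/-- The mean log-density `E log p(Y | A, H, S)`. -/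
def Model.meanLogS (n : ℕ) : ℝ := ∫ ω : Sample n, Real.log (M.densityS n ω.AH ω.S ω.Y) ∂(M.law n)

/-- The mean log-density `E log p(Y | A, H)`. -/
def Model.meanLog (n : ℕ) : ℝ := ∫ ω : Sample n,
  Real.log (marginalDensity (patternLaw M.f n) (M.densityS n) ω.AH ω.Y) ∂(M.law n)

/-- The hypotheses on the entries of `H` in dimension `n`. -/
structure Model.IsNormalized (n : ℕ) : Prop where
  memLp : 0 < n → MemLp id 2 (M.entryLaw n : Measure ℝ)
  mean : 0 < n → ∫ x, x ∂(M.entryLaw n : Measure ℝ) = 0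
  var : 0 < n → Var[id; (M.entryLaw n : Measure ℝ)] = 1 / n

variable {M} (h : M.IsNormalized n)
include h

theorem Model.IsNormalized.memLp_gain (i : Fin n) :
    MemLp (fun ω : Sample n => gain ω.AH ω.X i) 2 (M.law n) :=
  (memLp_gain_and_integral_sq_le M (h.memLp i.pos) (h.mean i.pos) (h.var i.pos) i).1

theorem integrable_log_densityX :
    Integrable (fun ω : Sample n => Real.log (densityX n ω.AH ω.X ω.Y)) (M.law n) := by
  simp_rw [Y_eq]
  exact integrable_log_shiftDensity h.memLp_gain (memLp_noise M)

theorem meanLogX_le : M.meanLogX n ≤ n * (M.variance + 1 / 2) := by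
  unfold Model.meanLogX
  simp_rw [Y_eq]
  refine (integral_log_shiftDensity_le h.memLp_gain (memLp_noise M)).trans ?_
  calc _ ≤ ∑ _i : Fin n, ((M.variance : ℝ) + 1 / 2) := Finset.sum_le_sum fun i _ => by
        have := (memLp_gain_and_integral_sq_le M (h.memLp i.pos) (h.mean i.pos) (h.var i.pos) i).2
        rw [integral_noise_sq]
        linarith
    _ = _ := by rw [Finset.sum_const, Finset.card_univ, Fintype.card_fin, nsmul_eq_mul]

/-- On the sample space `X` is by definition `sparseSignal S U`, so `densityU` and `densityX` take
the same value there. For the same reason `meanLogX` appears in `infoU_eq`. -/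
theorem integrable_log_densityU :
    Integrable (fun ω : Sample n => Real.log (densityU n (ω.AH, ω.S) ω.U ω.Y)) (M.law n) :=
  integrable_log_densityX h

theorem integrable_log_densityS :
    Integrable (fun ω : Sample n => Real.log (M.densityS n ω.AH ω.S ω.Y)) (M.law n) :=
  (hasCondDensity_U M).integrable_log_marginal isCondDensity_densityU (integrable_log_densityU h)

theorem integrable_log_marginalDensity : Integrable (fun ω : Sample n =>
    Real.log (marginalDensity (patternLaw M.f n) (M.densityS n) ω.AH ω.Y)) (M.law n) :=
  (hasCondDensity_S M).integrable_log_marginal (isCondDensity_densityS M)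
    (integrable_log_densityS h)

theorem infoX_eq :
    M.infoX n = ENNReal.ofReal (M.meanLogX n - M.meanLog n) / ENNReal.ofReal (Real.log 2) := by
  refine ((hasCondDensity_X M).condMutualInfo_eq isCondDensity_densityX
    (integrable_log_densityX h)).trans ?_
  simp_rw [marginalDensity_densityX]
  rfl

theorem infoU_eq :
    M.infoU n = ENNReal.ofReal (M.meanLogX n - M.meanLogS n) / ENNReal.ofReal (Real.log 2) :=
  (hasCondDensity_U M).condMutualInfo_eq isCondDensity_densityU (integrable_log_densityU h)

theorem infoS_eq :
    M.infoS n = ENNReal.ofReal (M.meanLogS n - M.meanLog n) / ENNReal.ofReal (Real.log 2) :=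
  (hasCondDensity_S M).condMutualInfo_eq (isCondDensity_densityS M) (integrable_log_densityS h)

theorem meanLog_nonneg : 0 ≤ M.meanLog n :=
  (hasCondDensity_S M).integral_log_marginal_nonneg (isCondDensity_densityS M)
    (integrable_log_densityS h)

theorem meanLog_le_meanLogS : M.meanLog n ≤ M.meanLogS n :=
  (hasCondDensity_S M).integral_log_marginal_le (isCondDensity_densityS M)
    (integrable_log_densityS h)

theorem meanLogS_le_meanLogX : M.meanLogS n ≤ M.meanLogX n :=
  (hasCondDensity_U M).integral_log_marginal_le isCondDensity_densityU (integrable_log_densityU h)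

end Informations

/-! ### The pattern channel with output `(A, H, Y)`, and codes for it. -/

section Reliability

variable (M : Model) {n : ℕ}

instance (s : Fin n → Bool) : IsProbabilityMeasure (M.channel s) := by
  refine Measure.isProbabilityMeasure_map (Measurable.aemeasurable ?_)
  simp_rw [received_eq]
  have hs : Measurable fun ω : ((Fin n → Bool) × (Fin n → Fin n → ℝ)) × (Fin n → ℝ) × (Fin n → ℝ) =>
      sparseSignal s ω.2.1 :=
    measurable_sparseSignal.comp (by fun_prop : Measurable fun
      ω : ((Fin n → Bool) × (Fin n → Fin n → ℝ)) × (Fin n → ℝ) × (Fin n → ℝ) => (s, ω.2.1))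
  exact measurable_fst.prodMk ((measurable_gain.comp (measurable_fst.prodMk hs)).add
    measurable_snd.snd)

/-- The weight of a pattern. -/
def patternWeight (f : ℝ → ℝ) (s : Fin n → Bool) : ℝ≥0∞ := ENNReal.ofReal (patternProb f s)

theorem sum_patternWeight (f : ℝ → ℝ) : ∑ s : Fin n → Bool, patternWeight f s = 1 := by
  have h := measure_univ (μ := patternLaw f n)
  simpa [patternLaw, patternWeight] using h

theorem lintegral_channel (s : Fin n → Bool) {f : Output n → ℝ≥0∞} (hf : Measurable f) :
    ∫⁻ o, f o ∂(M.channel s) = ∫⁻ z, ∫⁻ u, ∫⁻ w, f (z, gain z (sparseSignal s u) + w)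
      ∂(noiseLaw n) ∂(M.gaussianLaw n) ∂(M.samplingMatrixLaw n) := by
  have hs : Measurable fun ω : ((Fin n → Bool) × (Fin n → Fin n → ℝ)) × (Fin n → ℝ) × (Fin n → ℝ) =>
      sparseSignal s ω.2.1 :=
    measurable_sparseSignal.comp (by fun_prop : Measurable fun
      ω : ((Fin n → Bool) × (Fin n → Fin n → ℝ)) × (Fin n → ℝ) × (Fin n → ℝ) => (s, ω.2.1))
  have hm : Measurable fun ω : ((Fin n → Bool) × (Fin n → Fin n → ℝ)) × (Fin n → ℝ) × (Fin n → ℝ) =>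
      ((ω.1, gain ω.1 (sparseSignal s ω.2.1) + ω.2.2) : Output n) :=
    measurable_fst.prodMk ((measurable_gain.comp (measurable_fst.prodMk hs)).add measurable_snd.snd)
  unfold Model.channel
  simp_rw [received_eq]
  rw [lintegral_map hf hm]
  refine (lintegral_prod _ (hf.comp hm).aemeasurable).trans (lintegral_congr fun z => ?_)
  exact lintegral_prod _ ((hf.comp hm).comp (measurable_prodMk_left (x := z))).aemeasurable

/-- Links the two descriptions: feeding the channel a random pattern reproduces the law of the
model, so means under `jointMeasure` become means over the sample space. -/
theorem map_S_AH_Y : (M.law n).map (fun ω => (ω.S, (ω.AH, ω.Y))) =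
    jointMeasure (patternWeight M.f) (M.channel (n := n)) := by
  refine Measure.ext_of_lintegral _ fun f hf => ?_
  have hFm : Measurable fun ω : Sample n => f (ω.S, (ω.AH, ω.Y)) :=
    hf.comp (measurable_S.prodMk (measurable_AH.prodMk measurable_Y))
  rw [lintegral_map hf (measurable_S.prodMk (measurable_AH.prodMk measurable_Y))]
  have hF : Measurable fun ω : Sample n =>
      f (ω.2.1, (ω.1, gain ω.1 (sparseSignal ω.2.1 ω.2.2.1) + ω.2.2.2)) := by
    simp_rw [Y_eq] at hFm
    exact hFm
  simp_rw [Y_eq]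
  refine (lintegral_law M (F := fun z s u w => f (s, (z, gain z (sparseSignal s u) + w)))
    hF).trans ?_
  unfold jointMeasure patternLaw
  simp_rw [lintegral_finsetSum_measure, lintegral_smul_measure, lintegral_dirac, smul_eq_mul]
  have hs : ∀ s : Fin n → Bool, Measurable fun z : (Fin n → Bool) × (Fin n → Fin n → ℝ) =>
      ∫⁻ u, ∫⁻ w, f (s, (z, gain z (sparseSignal s u) + w)) ∂(noiseLaw n) ∂(M.gaussianLaw n) := by
    intro s
    have h1 : Measurable fun q : (((Fin n → Bool) × (Fin n → Fin n → ℝ)) × (Fin n → ℝ)) ×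
        (Fin n → ℝ) => f (s, (q.1.1, gain q.1.1 (sparseSignal s q.1.2) + q.2)) :=
      hF.comp (by fun_prop : Measurable fun q : (((Fin n → Bool) × (Fin n → Fin n → ℝ)) ×
        (Fin n → ℝ)) × (Fin n → ℝ) => ((q.1.1, (s, (q.1.2, q.2))) : Sample n))
    exact h1.lintegral_prod_right'.lintegral_prod_right'
  rw [lintegral_finsetSum _ fun s _ => (hs s).const_mul _]
  refine Finset.sum_congr rfl fun s _ => ?_
  have hfs : Measurable fun o : Output n => f (s, o) := hf.comp measurable_prodMk_left
  rw [lintegral_const_mul _ (hs s), Measure.dirac_prod, lintegral_map hf measurable_prodMk_left,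
    lintegral_channel M s hfs]
  rfl

theorem map_AH_Y : (M.law n).map (fun ω => (ω.AH, ω.Y)) =
    ∑ s, patternWeight M.f s • M.channel (n := n) s := by
  have h := congrArg (Measure.map Prod.snd) (map_S_AH_Y M (n := n))
  rw [Measure.map_map measurable_snd
    (measurable_S.prodMk (measurable_AH.prodMk measurable_Y))] at h
  refine Eq.trans h (Measure.ext fun t ht => ?_)
  rw [Measure.map_apply measurable_snd ht, jointMeasure]
  simp only [Measure.coe_finsetSum, Finset.sum_apply, Measure.smul_apply, smul_eq_mul]
  refine Finset.sum_congr rfl fun s _ => ?_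
  rw [← Measure.map_apply measurable_snd ht, Measure.map_snd_prod, measure_univ, one_smul]

theorem integral_magnetization_jointMeasure :
    ∫ p, magnetization p.1 ∂(jointMeasure (patternWeight M.f) (M.channel (n := n))) =
      M.sparsity n := by
  have hc : Measurable (magnetization : (Fin n → Bool) → ℝ) := measurable_of_finite _
  have hc' : Measurable fun p : (Fin n → Bool) × Output n => magnetization p.1 :=
    hc.comp measurable_fst
  rw [← map_S_AH_Y, integral_map
    (measurable_S.prodMk (measurable_AH.prodMk measurable_Y)).aemeasurable hc'.aestronglyMeasurable]
  have hmp : MeasurePreserving (Sample.S : Sample n → _) (M.law n) (patternLaw M.f n) :=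
    measurePreserving_fst.comp measurePreserving_snd
  exact integral_comp_measurePreserving hmp hc.aestronglyMeasurable

variable {M}

theorem reliable_of_lt (h : M.IsNormalized n) {r : ℝ}
    (hr : n * r * Real.log 2 < M.meanLogS n - M.meanLog n) : M.Reliable n r := by
  intro ε hε
  -- The information density of `S` and `(A, H, Y)`. Because `(A, H)` is independent of `S`,
  -- conditioning on it amounts to counting it as output; the mean of `i` is `I(S; Y | A, H)` in
  -- nats.
  let i : (Fin n → Bool) × Output n → ℝ := fun p => Real.log (M.densityS n p.2.1 p.1 p.2.2) -
    Real.log (marginalDensity (patternLaw M.f n) (M.densityS n) p.2.1 p.2.2)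
  have hS := isCondDensity_densityS M (n := n)
  have hm : Measurable fun ω : Sample n => (ω.S, (ω.AH, ω.Y)) :=
    measurable_S.prodMk (measurable_AH.prodMk measurable_Y)
  have hi : Measurable i :=
    (hS.measurable.comp (by fun_prop : Measurable fun p : (Fin n → Bool) × Output n =>
      (p.2.1, p.1, p.2.2))).log.sub ((hS.measurable_marginalDensity _).comp measurable_snd).log
  have hint : Integrable i (jointMeasure (patternWeight M.f) (M.channel (n := n))) := by
    rw [← map_S_AH_Y, integrable_map_measure hi.aestronglyMeasurable hm.aemeasurable]
    exact (integrable_log_densityS h).sub (integrable_log_marginalDensity h)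
  have hmean : ∫ p, i p ∂(jointMeasure (patternWeight M.f) (M.channel (n := n))) =
      M.meanLogS n - M.meanLog n := by
    rw [← map_S_AH_Y, integral_map hm.aemeasurable hi.aestronglyMeasurable]
    exact integral_sub (integrable_log_densityS h) (integrable_log_marginalDensity h)
  have hexp : ∀ s, ∫⁻ o, ENNReal.ofReal (Real.exp (i (s, o)))
      ∂(∑ s, patternWeight M.f s • M.channel (n := n) s) ≤ 1 := by
    intro s
    have hms : Measurable fun o : Output n => ENNReal.ofReal (Real.exp (i (s, o))) :=
      (hi.comp measurable_prodMk_left).exp.ennreal_ofReal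
    rw [← map_AH_Y, lintegral_map hms (measurable_AH.prodMk measurable_Y)]
    refine le_of_eq (Eq.trans (lintegral_congr fun ω => ?_)
      ((hasCondDensity_S M).lintegral_div_marginalDensity hS s))
    rw [Real.exp_sub, Real.exp_log (hS.pos _ _ _), Real.exp_log (hS.marginalDensity_pos _ _ _)]
  obtain ⟨N₀, hN₀⟩ := channel_coding (sum_patternWeight M.f) hi hint hexp magnetization
    (hmean ▸ hr) hε
  refine ⟨N₀, fun N hN => ?_⟩
  obtain ⟨K, encode, decode, hd, hK, herr⟩ := hN₀ N hN
  refine ⟨⟨K, encode, decode, hd⟩, ?_, fun m => ?_⟩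
  · rw [Real.rpow_def_of_pos two_pos]
    refine le_trans (le_of_eq ?_) hK
    congr 1
    ring
  · rw [integral_magnetization_jointMeasure] at herr
    exact herr m

end Reliability

/-! ### Finiteness, the linear bound in the dimension, and the passage to upper limits. -/

section Rates

variable {M : Model} {n : ℕ}

theorem ofReal_log_two_ne : ENNReal.ofReal (Real.log 2) ≠ 0 :=
  (ENNReal.ofReal_pos.2 (Real.log_pos one_lt_two)).ne'

theorem toReal_ofReal_div_log_two {t : ℝ} (ht : 0 ≤ t) :
    (ENNReal.ofReal t / ENNReal.ofReal (Real.log 2)).toReal = t / Real.log 2 := by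
  rw [ENNReal.toReal_div, ENNReal.toReal_ofReal ht,
    ENNReal.toReal_ofReal (Real.log_pos one_lt_two).le]

theorem infoX_ne_top (h : M.IsNormalized n) : M.infoX n ≠ ∞ := by
  rw [infoX_eq h]; exact ENNReal.div_ne_top ENNReal.ofReal_ne_top ofReal_log_two_ne

theorem infoU_ne_top (h : M.IsNormalized n) : M.infoU n ≠ ∞ := by
  rw [infoU_eq h]; exact ENNReal.div_ne_top ENNReal.ofReal_ne_top ofReal_log_two_ne

theorem infoS_ne_top (h : M.IsNormalized n) : M.infoS n ≠ ∞ := by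
  rw [infoS_eq h]; exact ENNReal.div_ne_top ENNReal.ofReal_ne_top ofReal_log_two_ne

theorem toReal_infoS (h : M.IsNormalized n) :
    (M.infoS n).toReal = (M.infoX n).toReal - (M.infoU n).toReal := by
  have h1 := meanLog_le_meanLogS h
  have h2 := meanLogS_le_meanLogX h
  rw [infoS_eq h, infoX_eq h, infoU_eq h, toReal_ofReal_div_log_two (by linarith),
    toReal_ofReal_div_log_two (by linarith), toReal_ofReal_div_log_two (by linarith)]
  ring

theorem infoU_le_infoX (h : M.IsNormalized n) : M.infoU n ≤ M.infoX n := by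
  have h1 := meanLog_le_meanLogS h
  rw [infoU_eq h, infoX_eq h]
  gcongr

/-- Dropping the nonnegative `meanLog` leaves `meanLogX`, which is linear in `n`. Proving `infoX ≤
constant * n` first also covers `n = 0`. -/
theorem infoX_div_le (h : M.IsNormalized n) :
    M.infoX n / n ≤ ENNReal.ofReal (M.variance + 1 / 2) / ENNReal.ofReal (Real.log 2) := by
  have h1 := meanLog_nonneg h
  have h2 := meanLogX_le h
  refine ENNReal.div_le_of_le_mul ?_
  calc M.infoX n ≤ ENNReal.ofReal ((M.variance + 1 / 2) * n) / ENNReal.ofReal (Real.log 2) := by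
        rw [infoX_eq h]
        gcongr
        linarith
    _ = _ := by
        rw [ENNReal.ofReal_mul (by positivity), ENNReal.ofReal_natCast, ENNReal.mul_div_right_comm]

theorem reliable_of_lt_sub (h : M.IsNormalized n) (hn : 0 < n) {r : ℝ}
    (hr : r < (M.infoX n / n).toReal - (M.infoU n / n).toReal) : M.Reliable n r := by
  have hn' : (0 : ℝ) < n := by exact_mod_cast hn
  have hl := Real.log_pos one_lt_two
  refine reliable_of_lt h ?_
  rw [ENNReal.toReal_div, ENNReal.toReal_div, ← sub_div, ← toReal_infoS h, infoS_eq h,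
    toReal_ofReal_div_log_two (sub_nonneg.2 (meanLog_le_meanLogS h)), ENNReal.toReal_natCast,
    div_div, lt_div_iff₀ (by positivity)] at hr
  linarith

end Rates

/-- If `limsup a` and `limsup b` are finite, then `a - b` exceeds every number below the difference
of the upper limits infinitely often. -/
theorem frequently_lt_toReal_sub_toReal {a b : ℕ → ℝ≥0∞} (ha : ∀ᶠ n in atTop, a n ≠ ∞)
    (hbfin : limsup b atTop ≠ ∞) {r : ℝ}
    (hr : r < (limsup a atTop).toReal - (limsup b atTop).toReal) :
    ∃ᶠ n in atTop, r < (a n).toReal - (b n).toReal := by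
  by_contra hcon
  rw [not_frequently] at hcon
  set δ := ((limsup a atTop).toReal - (limsup b atTop).toReal - r) / 2 with hδ
  have hδ0 : 0 < δ := by rw [hδ]; linarith
  have hb : ∀ᶠ n in atTop, b n < ENNReal.ofReal ((limsup b atTop).toReal + δ) := by
    refine eventually_lt_of_limsup_lt ?_
    rw [ENNReal.lt_ofReal_iff_toReal_lt hbfin]
    linarith
  -- If `a - b ≤ r` eventually, then `a` is eventually at most `limsup b + δ + r`. As `δ` is half
  -- the gap in `hr`, this falls short of `limsup a` by `δ`.
  have hle : limsup a atTop ≤ ENNReal.ofReal ((limsup b atTop).toReal + δ + r) := by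
    refine limsup_le_of_le (by isBoundedDefault) ?_
    filter_upwards [ha, hb, hcon] with n h1 h2 h3
    rw [← ENNReal.ofReal_toReal h1]
    refine ENNReal.ofReal_le_ofReal ?_
    have h4 := (ENNReal.lt_ofReal_iff_toReal_lt h2.ne_top).1 h2
    linarith
  -- `r` may be negative, and `ENNReal.ofReal` would truncate a negative bound to zero. Some `a n ≥
  -- 0` obeys the bound, which rules this out.
  have h5 : 0 ≤ (limsup b atTop).toReal + δ + r := by
    obtain ⟨n, h1, h2, h3⟩ := (ha.and (hb.and hcon)).exists
    have h4 := (ENNReal.lt_ofReal_iff_toReal_lt h2.ne_top).1 h2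
    have h6 := ENNReal.toReal_nonneg (a := a n)
    linarith
  have h7 := ENNReal.toReal_mono ENNReal.ofReal_ne_top hle
  rw [ENNReal.toReal_ofReal h5] at h7
  linarith

end

end SparseChannel

theorem mainTheorem6 (M : SparseChannel.Model)
    (hL2 : ∀ n : ℕ, 0 < n → MemLp id 2 (M.entryLaw n : Measure ℝ))
    (hmean : ∀ n : ℕ, 0 < n → ∫ x, x ∂(M.entryLaw n : Measure ℝ) = 0)
    (hvar : ∀ n : ℕ, 0 < n → Var[id; (M.entryLaw n : Measure ℝ)] = 1 / n) :
    -- the mutual informations are finite and satisfy the identity, in every dimension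
    (∀ n : ℕ, M.infoX n ≠ ∞ ∧ M.infoU n ≠ ∞ ∧ M.infoS n ≠ ∞ ∧
      (M.infoS n).toReal = (M.infoX n).toReal - (M.infoU n).toReal) ∧
    -- the information rates are finite and their difference is achievable
    M.rateX ≠ ∞ ∧ M.rateU ≠ ∞ ∧
    M.Achievable (M.rateX.toReal - M.rateU.toReal) ∧
    -- where the upper limits are limits, all sufficiently large dimensions can be used
    (Tendsto (fun n : ℕ => M.infoX n / n) atTop (𝓝 M.rateX) →
      Tendsto (fun n : ℕ => M.infoU n / n) atTop (𝓝 M.rateU) →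
      ∀ r : ℝ, r < M.rateX.toReal - M.rateU.toReal → ∀ᶠ n : ℕ in atTop, M.Reliable n r) := by
  have h : ∀ n, M.IsNormalized n := fun n => ⟨hL2 n, hmean n, hvar n⟩
  have hC : ENNReal.ofReal (M.variance + 1 / 2) / ENNReal.ofReal (Real.log 2) ≠ ∞ :=
    ENNReal.div_ne_top ENNReal.ofReal_ne_top SparseChannel.ofReal_log_two_ne
  have hX : ∀ᶠ n : ℕ in atTop, M.infoX n / n ≤
      ENNReal.ofReal (M.variance + 1 / 2) / ENNReal.ofReal (Real.log 2) :=
    .of_forall fun n => SparseChannel.infoX_div_le (h n)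
  have hU : ∀ᶠ n : ℕ in atTop, M.infoU n / n ≤
      ENNReal.ofReal (M.variance + 1 / 2) / ENNReal.ofReal (Real.log 2) := by
    filter_upwards [hX] with n hn
    exact (ENNReal.div_le_div_right (SparseChannel.infoU_le_infoX (h n)) _).trans hn
  have hrX : M.rateX ≠ ∞ := ne_top_of_le_ne_top hC (limsup_le_of_le (by isBoundedDefault) hX)
  have hrU : M.rateU ≠ ∞ := ne_top_of_le_ne_top hC (limsup_le_of_le (by isBoundedDefault) hU)
  refine ⟨fun n => ⟨SparseChannel.infoX_ne_top (h n), SparseChannel.infoU_ne_top (h n),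
    SparseChannel.infoS_ne_top (h n), SparseChannel.toReal_infoS (h n)⟩,
    hrX, hrU, fun r hr => ?_, fun hlX hlU r hr => ?_⟩
  · have hf := SparseChannel.frequently_lt_toReal_sub_toReal
      (hX.mono fun n hn => ne_top_of_le_ne_top hC hn)
      hrU hr
    -- Dimension `0` is discarded because rates divide by `n`.
    exact (hf.and_eventually (eventually_gt_atTop 0)).mono fun n hn =>
      SparseChannel.reliable_of_lt_sub (h n) hn.2 hn.1
  · have hl := ((ENNReal.tendsto_toReal hrX).comp hlX).sub ((ENNReal.tendsto_toReal hrU).comp hlU)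
    filter_upwards [hl.eventually_const_lt hr, eventually_gt_atTop 0] with n hn hn0
    exact SparseChannel.reliable_of_lt_sub (h n) hn0 hn
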